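/- Let $d\ge 1$ and $1\le k\le 2d$ be integers, and let $\mathbb{L}^d=(\mathbb{Z}^d,\mathcal{E}^d)$ be the hypercubic lattice with nearest-neighbour edges. Let $(U_e)_{e\in\mathcal{E}^d}$ be i.i.d. random variables, uniform on $[0,1]$, with law $\mathbb{P}$ on $[0,1]^{\mathcal{E}^d}$. In constrained-degree percolation with constraint $k$ all edges are initially closed; an edge $e=\langle u,v\rangle$ opens at time $U_e$ if, at every time $s<U_e$, each of $u$ and $v$ is incident to fewer than $k$ open edges, and otherwise it stays closed forever; an open edge remains open. (Almost surely this rule determines the state of every edge at every time.) Let $\theta(t)$ be the probability that the origin lies in an infinite connected component of the graph formed by the edges that are open at time $t$, and let $t_c=\inf\{t\in[0,1]:\theta(t)>0\}$, with $t_c=1$ if this set is empty. Then $\theta$ is continuous on the open interval $(t_c,1)$. -/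

import Mathlib

open MeasureTheory

noncomputable section

namespace CDP

/-- The hypercubic lattice: vertex set `ℤ^d`, with an edge between any two vertices at
`ℓ¹`-distance one. -/
def lattice (d : ℕ) : SimpleGraph (Fin d → ℤ) where
  Adj x y := ∑ i, |x i - y i| = 1
  symm := ⟨fun x y h => by simpa only [abs_sub_comm] using h⟩
  loopless := ⟨fun x h => by simp at h⟩

/-- The (unoriented) nearest-neighbour edges of `ℤ^d`. -/
abbrev Edge (d : ℕ) : Type := (lattice d).edgeSet

/-- A collection of clocks `U = (U_e)`, one number in `[0,1]` for every edge. -/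
abbrev Clocks (d : ℕ) : Type := Edge d → unitInterval

/-- The law of i.i.d. clocks that are uniform on `[0,1]`: the product measure on `[0,1]^E`. -/
def clockMeasure (d : ℕ) : Measure (Clocks d) :=
  Measure.infinitePi (fun _ : Edge d => (volume : Measure unitInterval))

variable {d : ℕ}

/-- `f` shares a vertex with `e` and its clock rings strictly earlier. -/
def Earlier (U : Clocks d) (f e : Edge d) : Prop :=
  (∃ v, v ∈ f.1 ∧ v ∈ e.1) ∧ U f < U e

open Classical in
/-- The edges that succeed in opening when their clock rings. The edge `e` succeeds if each of
its end-vertices `v` is incident to fewer than `k` edges that rang strictly before `e` and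
succeeded. This is a recursion along `Earlier U`, which is well-founded for almost every `U`
(almost surely there is no infinite sequence of successively adjacent edges with decreasing
clocks); on the remaining null set of clocks no edge opens. -/
def Succeeds (k : ℕ) (U : Clocks d) : Edge d → Prop :=
  if h : WellFounded (Earlier U) then
    h.fix (C := fun _ => Prop) fun e ih =>
      ∀ v ∈ e.1, {f : Edge d | v ∈ f.1 ∧ ∃ hf : Earlier U f e, ih f hf}.encard < k
  else fun _ => False

/-- The configuration at time `t`: `IsOpen k U t e` says that the edge `e` is open at time `t`
in the process with constraint `k` and clocks `U`. -/
def IsOpen (k : ℕ) (U : Clocks d) (t : ℝ) (e : Edge d) : Prop :=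
  (U e : ℝ) ≤ t ∧ Succeeds k U e

/-- The dynamics of constrained-degree percolation, for a time-dependent configuration `ω`:
the edge `e` is open at time `t` if and only if its clock has rung by time `t` and, at all times
before its clock rang, both of its end-vertices had fewer than `k` incident open edges. -/
def FollowsDynamics (k : ℕ) (U : Clocks d) (ω : ℝ → Edge d → Prop) : Prop :=
  ∀ t e, ω t e ↔ (U e : ℝ) ≤ t ∧
    ∀ s : ℝ, s < U e → ∀ v ∈ e.1, {f : Edge d | v ∈ f.1 ∧ ω s f}.encard < k

theorem succeeds_iff (k : ℕ) (U : Clocks d) (h : WellFounded (Earlier U)) (e : Edge d) :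
    Succeeds k U e ↔
      ∀ v ∈ e.1, {f : Edge d | v ∈ f.1 ∧ U f < U e ∧ Succeeds k U f}.encard < k := by
  have key : Succeeds k U = h.fix (C := fun _ => Prop) fun e ih =>
      ∀ v ∈ e.1, {f : Edge d | v ∈ f.1 ∧ ∃ hf : Earlier U f e, ih f hf}.encard < k := by
    unfold Succeeds
    rw [dif_pos h]
  conv_lhs => rw [key, h.fix_eq, ← key]
  refine forall₂_congr fun v hv => ?_
  have : {f : Edge d | v ∈ f.1 ∧ ∃ _ : Earlier U f e, Succeeds k U f} =
      {f : Edge d | v ∈ f.1 ∧ U f < U e ∧ Succeeds k U f} := by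
    ext f
    constructor
    · rintro ⟨h1, h2, h3⟩
      exact ⟨h1, h2.2, h3⟩
    · rintro ⟨h1, h2, h3⟩
      exact ⟨h1, ⟨⟨v, h1, hv⟩, h2⟩, h3⟩
  rw [this]

/-- If, for every `s < a`, fewer than `k` elements of `S` ring by time `s`, then fewer than `k`
elements of `S` ring strictly before time `a`. -/
theorem encard_lt_iff {α : Type*} (k : ℕ) (S : Set α) (c : α → ℝ) (a : ℝ) :
    {f | f ∈ S ∧ c f < a}.encard < k ↔ ∀ s < a, {f | f ∈ S ∧ c f ≤ s}.encard < k := by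
  constructor
  · intro h s hs
    have hsub : {f | f ∈ S ∧ c f ≤ s} ⊆ {f | f ∈ S ∧ c f < a} :=
      fun f hf => ⟨hf.1, hf.2.trans_lt hs⟩
    exact (Set.encard_le_encard hsub).trans_lt h
  · intro h
    by_contra! hk
    obtain ⟨T, hT, hTk⟩ := Set.exists_subset_encard_eq hk
    have hfin : T.Finite := Set.finite_of_encard_eq_coe hTk
    obtain ⟨s, hsa, hs⟩ : ∃ s < a, ∀ f ∈ T, c f ≤ s := by
      rcases T.eq_empty_or_nonempty with rfl | hne
      · exact ⟨a - 1, by linarith, by simp⟩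
      · obtain ⟨f, hf, hmax⟩ := Set.exists_max_image T c hfin hne
        exact ⟨c f, (hT hf).2, hmax⟩
    have hsub : T ⊆ {f | f ∈ S ∧ c f ≤ s} := fun f hf => ⟨(hT hf).1, hs f hf⟩
    have := (Set.encard_le_encard hsub).trans_lt (h s hsa)
    rw [hTk] at this
    exact lt_irrefl _ this

/-- Whenever `Earlier U` is well-founded, `IsOpen k U` is the one and only time-dependent
configuration that follows the dynamics of constrained-degree percolation. -/
theorem followsDynamics_iff (k : ℕ) (U : Clocks d) (h : WellFounded (Earlier U))
    (ω : ℝ → Edge d → Prop) : FollowsDynamics k U ω ↔ ω = IsOpen k U := by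
  have aux : ∀ (A : Edge d → Prop) (e : Edge d),
      (∀ v ∈ e.1, {f : Edge d | v ∈ f.1 ∧ U f < U e ∧ A f}.encard < k) ↔
      ∀ s : ℝ, s < U e → ∀ v ∈ e.1,
        {f : Edge d | v ∈ f.1 ∧ (U f : ℝ) ≤ s ∧ A f}.encard < k := by
    intro A e
    have h1 : ∀ v, {f : Edge d | v ∈ f.1 ∧ U f < U e ∧ A f} =
        {f | f ∈ {f : Edge d | v ∈ f.1 ∧ A f} ∧ (U f : ℝ) < U e} := by
      intro v; ext f; simp only [Set.mem_ofPred_eq, Subtype.coe_lt_coe]; tauto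
    have h2 : ∀ v (s : ℝ), {f : Edge d | v ∈ f.1 ∧ (U f : ℝ) ≤ s ∧ A f} =
        {f | f ∈ {f : Edge d | v ∈ f.1 ∧ A f} ∧ (U f : ℝ) ≤ s} := by
      intro v s; ext f; simp only [Set.mem_ofPred_eq]; tauto
    simp only [h1, h2, encard_lt_iff]
    exact ⟨fun H s hs v hv => H v hv s hs, fun H v hv s hs => H s hs v hv⟩
  constructor
  · intro hω
    have hmono : ∀ t e, ω t e ↔ (U e : ℝ) ≤ t ∧ ω (U e) e := by
      intro t e
      rw [hω t e, hω (U e) e]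
      simp
    have hS : ∀ e, ω (U e) e ↔ Succeeds k U e := by
      intro e
      induction e using h.induction with
      | _ e ih =>
        have hset : ∀ v (s : ℝ), {f : Edge d | v ∈ f.1 ∧ ω s f} =
            {f : Edge d | v ∈ f.1 ∧ (U f : ℝ) ≤ s ∧ ω (U f) f} := by
          intro v s; ext f
          exact and_congr_right fun _ => hmono s f
        rw [succeeds_iff k U h, hω]
        simp only [le_refl, true_and, hset]
        rw [← aux (fun f => ω (U f) f) e]
        refine forall₂_congr fun v hv => ?_
        have : {f : Edge d | v ∈ f.1 ∧ U f < U e ∧ ω (U f) f} =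
            {f : Edge d | v ∈ f.1 ∧ U f < U e ∧ Succeeds k U f} := by
          ext f
          constructor
          · rintro ⟨h1, h2, h3⟩
            exact ⟨h1, h2, (ih f ⟨⟨v, h1, hv⟩, h2⟩).1 h3⟩
          · rintro ⟨h1, h2, h3⟩
            exact ⟨h1, h2, (ih f ⟨⟨v, h1, hv⟩, h2⟩).2 h3⟩
        rw [this]
    funext t e
    exact propext ((hmono t e).trans (and_congr_right fun _ => hS e))
  · rintro rfl t e
    exact and_congr_right fun _ => (succeeds_iff k U h e).trans (aux (Succeeds k U) e)

/-- The random subgraph of the lattice formed by the edges that are open at time `t`. -/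
def openGraph (k : ℕ) (U : Clocks d) (t : ℝ) : SimpleGraph (Fin d → ℤ) where
  Adj x y := ∃ h : (lattice d).Adj x y, IsOpen k U t ⟨s(x, y), h⟩
  symm := ⟨fun x y ⟨h, ho⟩ => ⟨h.symm, by
    have e : (⟨s(y, x), h.symm⟩ : Edge d) = ⟨s(x, y), h⟩ := Subtype.ext Sym2.eq_swap
    rwa [e]⟩⟩
  loopless := ⟨fun x ⟨h, _⟩ => (lattice d).loopless.irrefl x h⟩

/-- The open cluster of the vertex `x` at time `t`. -/
def cluster (k : ℕ) (U : Clocks d) (t : ℝ) (x : Fin d → ℤ) : Set (Fin d → ℤ) :=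
  {y | (openGraph k U t).Reachable x y}

variable (d)

/-- The percolation function: the probability that the open cluster of the origin at time `t`
is infinite. -/
def theta (k : ℕ) (t : ℝ) : ℝ :=
  (clockMeasure d).real {U | (cluster k U t 0).Infinite}

/-- The critical threshold `inf {t ∈ [0,1] : θ(t) > 0}`. The infimum is taken in the complete
lattice `[0,1]`, so that it is `1` when `θ` vanishes identically. -/
def criticalTime (k : ℕ) : unitInterval :=
  sInf {t : unitInterval | 0 < theta d k t}

end CDP

end

/-! Whether an edge succeeds does not depend on the time of observation, so the open graph and
`theta` increase with `t`, and continuity reduces to one-sided limits. From the right: a finite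
cluster at time `t` touches finitely many edges, so for a short while after `t` none of them rings
and the cluster does not grow (`iInter_percolates`). From the left, take `s < t` with `theta d k s >
0`. By ergodicity some infinite cluster exists almost surely at time `s`; by uniqueness at time `t`,
an infinite cluster of the origin contains it; and the connecting path is open already shortly
before `t`, because no clock equals `t` (`ae_percolates_le_iUnion`).

Uniqueness for `0 < t < 1` (`ae_not_infMany_two`) follows Burton and Keane. The usual finite-energy
property is not available, since changing one clock may alter distant edges. Its substitute is
`ae_forall_isEdit_not`: every finite modification of the open graph with degrees at most `k` is
produced by changing finitely many clocks to a pattern of positive probability (`exists_resample`).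
The resampled edges are chosen so that a closed edge which keeps its clock also keeps the open edges
that blocked it.

For `k ≥ 3`, three infinite clusters could be edited into a trifurcation, which amenability of the
lattice excludes (`card_trif_le`); two, but not three, could be edited into at most one or at least
three, against ergodicity. For `k ≤ 2` all degrees are at most two, and an infinite cluster could be
cut to have an end-vertex; the same counting excludes such tips (`card_tip_le`), so there is no
infinite cluster at all. -/

noncomputable section

namespace CDP

/-! ### Deterministic counting of trifurcations and tips in a finite set. -/

section Graph

variable {V : Type*} {G G' H L : SimpleGraph V}

/-- The graph `G` with all edges that touch `S` deleted. -/
def clear (G : SimpleGraph V) (S : Set V) : SimpleGraph V where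
  Adj a b := G.Adj a b ∧ a ∉ S ∧ b ∉ S
  symm := ⟨fun _ _ h => ⟨h.1.symm, h.2.2, h.2.1⟩⟩
  loopless := ⟨fun x h => G.loopless.irrefl x h.1⟩

/-- The component of `x` in `G` is infinite. -/
def InfAt (G : SimpleGraph V) (x : V) : Prop := {y | G.Reachable x y}.Infinite

/-- `x` has three neighbours that lie in three different infinite components of `G - x`. -/
def IsTrif (G : SimpleGraph V) (x : V) : Prop :=
  ∃ a : Fin 3 → V, (∀ i, G.Adj x (a i)) ∧ (∀ i, InfAt (clear G {x}) (a i)) ∧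
    ∀ i j, i ≠ j → ¬ (clear G {x}).Reachable (a i) (a j)

theorem clear_le (G : SimpleGraph V) (S : Set V) : clear G S ≤ G := fun _ _ h => h.1

theorem InfAt.of_reachable {x y : V} (h : InfAt G x) (hxy : G.Reachable x y) : InfAt G y := by
  refine h.mono fun z hz => ?_
  exact hxy.symm.trans hz

theorem InfAt.mono (hle : G ≤ G') {x : V} (h : InfAt G x) : InfAt G' x :=
  Set.Infinite.mono (fun _ hz => SimpleGraph.Reachable.mono hle hz) h

/-- A property that passes to neighbours passes to the whole component. -/
theorem reachable_induction {P : V → Prop} {a v : V} (h : G.Reachable a v) (ha : P a)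
    (hstep : ∀ x y, G.Reachable a x → P x → G.Adj x y → P y) : P v := by
  obtain ⟨p⟩ := h
  have key : ∀ (u w : V) (q : G.Walk u w), G.Reachable a u → P u → P w := by
    intro u w q
    induction q with
    | nil => exact fun _ h => h
    | cons hadj _ ih => exact fun hu hPu => ih (hu.trans hadj.reachable) (hstep _ _ hu hPu hadj)
  exact key a v p .rfl ha

theorem not_mem_of_clear_reachable {S : Set V} {a v : V} (h : (clear G S).Reachable a v)
    (ha : a ∉ S) : v ∉ S :=
  reachable_induction (P := fun v => v ∉ S) h ha fun _ _ _ _ hadj => hadj.2.2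

/-- A walk that stays in a component of `G - x` missing `y` avoids `y`, so the deleted vertex may be
exchanged. -/
theorem clear_singleton_reachable_of_not_reachable {x y a v : V}
    (h : (clear G {x}).Reachable a v) (hy : ¬ (clear G {x}).Reachable a y) :
    (clear G {y}).Reachable a v := by
  refine reachable_induction (P := fun v => (clear G {y}).Reachable a v) h .rfl ?_
  intro u w hu ih hadj
  refine ih.trans (SimpleGraph.Adj.reachable ⟨hadj.1, ?_, ?_⟩)
  · rintro rfl; exact hy hu
  · rintro rfl; exact hy (hu.trans hadj.reachable)

/-- A walk from outside `S` into `S` has a first step into `S`. -/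
theorem exists_adj_of_reachable {S : Set V} {a x : V} (h : G.Reachable a x) (ha : a ∉ S)
    (hx : x ∈ S) : ∃ b y, y ∈ S ∧ b ∉ S ∧ G.Adj b y ∧ (clear G S).Reachable a b := by
  obtain ⟨p⟩ := h
  induction p with
  | nil => exact absurd hx ha
  | @cons u c w hadj p ih =>
    by_cases hc : c ∈ S
    · exact ⟨u, c, hc, ha, hadj, .rfl⟩
    · obtain ⟨b, y, hy, hb, hby, hr⟩ := ih hc hx
      exact ⟨b, y, hy, hb, hby, SimpleGraph.Reachable.trans
        (SimpleGraph.Adj.reachable ⟨hadj, ha, hc⟩) hr⟩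

/-- Stop a walk from `r` at its first arrival at `x`: until then it stays in the component of `r` in
`G - x`, which misses `y`. -/
theorem clear_singleton_reachable_of_walk {r x y : V} (h : G.Reachable r x) (hyx : y ≠ x)
    (hy : ¬ (clear G {x}).Reachable r y) : (clear G {y}).Reachable r x := by
  by_cases hrx : r = x
  · rw [hrx]
  obtain ⟨b, y', hy', hb, hadj, hr⟩ := exists_adj_of_reachable (S := {x}) h hrx rfl
  obtain rfl : y' = x := hy'
  refine (clear_singleton_reachable_of_not_reachable hr hy).trans
    (SimpleGraph.Adj.reachable ⟨hadj, ?_, hyx.symm⟩)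
  rintro rfl
  exact hy hr

/-- Counting lemma for laminar families: if every point of `T` has two disjoint branches, the
branches are nested in a tree-like way, and each branch meets `L`, then `T` is no larger
than `L`. -/
theorem card_le_card_of_laminar [DecidableEq V] (D : V → Bool → Set V) (T L : Finset V)
    (hdisj : ∀ x ∈ T, Disjoint (D x false) (D x true))
    (hself : ∀ x ∈ T, ∀ i, x ∉ D x i)
    (hnest : ∀ x ∈ T, ∀ y ∈ T, ∀ i, y ∈ D x i → ∀ j, D y j ⊆ D x i)
    (hsep : ∀ x ∈ T, ∀ y ∈ T, x ≠ y → (∀ i, y ∉ D x i) → (∀ j, x ∉ D y j) →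
      ∀ i j, Disjoint (D x i) (D y j))
    (hL : ∀ x ∈ T, ∀ i, ∃ v ∈ L, v ∈ D x i) : T.card ≤ L.card := by
  classical
  induction hn : T.card generalizing T L with
  | zero => omega
  | succ n ih =>
    have hne : T.Nonempty := Finset.card_pos.1 (by omega)
    -- Minimise the number of points of `T` in the branches. A point of `T` inside a branch of the
    -- minimiser would have strictly fewer, as it does not lie in its own branches; so these
    -- branches contain none.
    obtain ⟨x, hxT, hxmin⟩ := Finset.exists_min_image T
      (fun x => (T.filter (fun y => ∃ i, y ∈ D x i)).card) hne
    have hfree : ∀ y ∈ T, ∀ i, y ∉ D x i := by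
      intro y hy i hyi
      refine absurd (hxmin y hy) (not_le.2 (Finset.card_lt_card ?_))
      refine (Finset.ssubset_iff_of_subset fun z hz => ?_).2 ⟨y, ?_, ?_⟩
      · simp only [Finset.mem_filter] at hz ⊢
        obtain ⟨hz, j, hj⟩ := hz
        exact ⟨hz, i, hnest x hxT y hy i hyi j hj⟩
      · simp only [Finset.mem_filter]
        exact ⟨hy, i, hyi⟩
      · simp only [Finset.mem_filter, not_and, not_exists]
        exact fun _ => hself y hy
    have hcase : ∀ y ∈ T.erase x, ∀ j, (∀ i, D x i ⊆ D y j) ∨ (∀ i, Disjoint (D x i) (D y j)) := by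
      intro y hy j
      obtain ⟨hyx, hyT⟩ := Finset.mem_erase.1 hy
      by_cases hj : x ∈ D y j
      · exact .inl fun i => hnest y hyT x hxT j hj i
      by_cases hj' : ∃ j', x ∈ D y j'
      · obtain ⟨j', hj'⟩ := hj'
        have hd : Disjoint (D y j') (D y j) := by
          have := hdisj y hyT
          cases j <;> cases j' <;> first | exact absurd hj' hj | exact this | exact this.symm
        exact .inr fun i => hd.mono_left (hnest y hyT x hxT j' hj' i)
      · push Not at hj'
        exact .inr fun i => hsep x hxT y hyT hyx.symm (hfree y hyT) hj' i j
    have hcard : (T.erase x).card = n := by rw [Finset.card_erase_of_mem hxT]; omega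
    have hmem : ∀ {y}, y ∈ T.erase x → y ∈ T := fun h => Finset.mem_of_mem_erase h
    -- Discard `x` and the points of `L` in one of its branches. A remaining branch that contains
    -- the discarded one also contains `D x true`, whose point of `L` survives.
    have := ih (T.erase x) (L.filter (· ∉ D x false))
      (fun y hy => hdisj y (hmem hy)) (fun y hy => hself y (hmem hy))
      (fun y hy z hz => hnest y (hmem hy) z (hmem hz))
      (fun y hy z hz => hsep y (hmem hy) z (hmem hz)) (by
        intro y hy j
        rcases hcase y hy j with h | h
        · obtain ⟨v, hv, hvD⟩ := hL x hxT true
          exact ⟨v, Finset.mem_filter.2 ⟨hv, (Set.disjoint_left.1 (hdisj x hxT)).mt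
            (by simpa using hvD)⟩, h true hvD⟩
        · obtain ⟨v, hv, hvD⟩ := hL y (hmem hy) j
          exact ⟨v, Finset.mem_filter.2 ⟨hv, Set.disjoint_right.1 (h false) hvD⟩, hvD⟩) hcard
    have hlt : (L.filter (· ∉ D x false)).card < L.card := by
      obtain ⟨v, hv, hvD⟩ := hL x hxT false
      exact Finset.card_lt_card (Finset.filter_ssubset.2 ⟨v, hv, by simpa using hvD⟩)
    omega

/-- An infinite component that touches `B` meets the boundary `B'` of `B`. -/
theorem exists_mem_boundary {B B' : Finset V} (hle : H ≤ G)
    (hB : ∀ x ∈ B, ∀ y, G.Adj x y → y ∈ B ∨ y ∈ B') {a : V} (ha : a ∈ B ∨ a ∈ B')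
    (hinf : InfAt H a) : ∃ v ∈ B', H.Reachable a v := by
  by_contra! hno
  refine hinf (B.finite_toSet.subset fun v hv => ?_)
  refine reachable_induction (P := fun v => v ∈ B) hv
    (ha.resolve_right fun h => hno a h .rfl) ?_
  intro u w hu huB hadj
  exact (hB u huB w (hle hadj)).resolve_right fun h => hno w h (hu.trans hadj.reachable)

/-- At most one of the three branches contains the root `r`; the other two point away from it. -/
theorem IsTrif.exists_branches {x : V} (h : IsTrif G x) (r : V) :
    ∃ b : Bool → V, (∀ i, G.Adj x (b i)) ∧ (∀ i, InfAt (clear G {x}) (b i)) ∧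
      ¬ (clear G {x}).Reachable (b false) (b true) ∧ ∀ i, ¬ (clear G {x}).Reachable (b i) r := by
  obtain ⟨a, hadj, hinf, hsep⟩ := h
  have key : ∃ i j, i ≠ j ∧ ¬ (clear G {x}).Reachable (a i) r ∧
      ¬ (clear G {x}).Reachable (a j) r := by
    by_cases h0 : (clear G {x}).Reachable (a 0) r
    · exact ⟨1, 2, by decide, fun h => hsep 1 0 (by decide) (h.trans h0.symm),
        fun h => hsep 2 0 (by decide) (h.trans h0.symm)⟩
    by_cases h1 : (clear G {x}).Reachable (a 1) r
    · exact ⟨0, 2, by decide, h0, fun h => hsep 2 1 (by decide) (h.trans h1.symm)⟩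
    · exact ⟨0, 1, by decide, h0, h1⟩
  obtain ⟨i, j, hij, hi, hj⟩ := key
  refine ⟨fun c => cond c (a j) (a i), ?_, ?_, hsep i j hij, ?_⟩
  · rintro (_ | _) <;> exact hadj _
  · rintro (_ | _) <;> exact hinf _
  · rintro (_ | _) <;> assumption

/-- Burton and Keane's bound: a finite set contains no more trifurcations than its boundary
has points. -/
theorem card_trif_le [DecidableEq V] {B B' T : Finset V}
    (hB : ∀ x ∈ B, ∀ y, G.Adj x y → y ∈ B ∨ y ∈ B') (hTB : T ⊆ B) (hT : ∀ x ∈ T, IsTrif G x) :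
    T.card ≤ B'.card := by
  classical
  -- A root in every component. Keeping only branches that avoid the root makes them nested like
  -- sets of descendants in a tree.
  set r : V → V := fun x => (G.connectedComponentMk x).out with hr
  have hrx : ∀ x, G.Reachable (r x) x := fun x =>
    SimpleGraph.ConnectedComponent.exact (Quot.out_eq (G.connectedComponentMk x))
  have hreq : ∀ x y, G.Reachable x y → r x = r y := fun x y h => by
    simp only [hr, SimpleGraph.ConnectedComponent.sound h]
  have hbr : ∀ x, ∃ b : Bool → V, x ∈ T → (∀ i, G.Adj x (b i)) ∧
      (∀ i, InfAt (clear G {x}) (b i)) ∧ ¬ (clear G {x}).Reachable (b false) (b true) ∧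
      ∀ i, ¬ (clear G {x}).Reachable (b i) (r x) := by
    intro x
    by_cases hx : x ∈ T
    · obtain ⟨b, hb⟩ := (hT x hx).exists_branches (r x)
      exact ⟨b, fun _ => hb⟩
    · exact ⟨fun _ => x, fun h => absurd h hx⟩
  choose b hb using hbr
  have hself : ∀ x ∈ T, ∀ i, ¬ (clear G {x}).Reachable (b x i) x := fun x hx i h =>
    not_mem_of_clear_reachable h (fun e => ((hb x hx).1 i).ne e.symm) rfl
  refine card_le_card_of_laminar (fun x i => {v | (clear G {x}).Reachable (b x i) v}) T B'
    ?_ hself ?_ ?_ ?_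
  · intro x hx
    refine Set.disjoint_left.2 fun v h0 h1 => (hb x hx).2.2.1 ?_
    exact SimpleGraph.Reachable.trans h0 (SimpleGraph.Reachable.symm h1)
  · intro x hx y hy i hyx j v hv
    have hyx : (clear G {x}).Reachable (b x i) y := hyx
    have hv : (clear G {y}).Reachable (b y j) v := hv
    have hne : y ≠ x := by rintro rfl; exact hself _ hx _ hyx
    have hxy : G.Reachable x y := ((hb x hx).1 i).reachable.trans (hyx.mono (clear_le _ _))
    -- As `y` lies in a branch of `x` away from the root, `x` is on the root side of `y` and in no
    -- chosen branch of `y`.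
    have h1 : (clear G {y}).Reachable (r x) x := clear_singleton_reachable_of_walk (hrx x) hne
      fun h => (hb x hx).2.2.2 i (hyx.trans h.symm)
    have h2 : ¬ (clear G {y}).Reachable (b y j) x := fun h =>
      (hb y hy).2.2.2 j (hreq x y hxy ▸ h.trans h1.symm)
    have h3 : (clear G {x}).Adj y (b y j) :=
      ⟨(hb y hy).1 j, hne, by rintro rfl; exact h2 .rfl⟩
    exact (hyx.trans h3.reachable).trans (clear_singleton_reachable_of_not_reachable hv h2)
  · intro x hx y hy hne hyx hxy i j
    refine Set.disjoint_left.2 fun w hw hw' => hxy j ?_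
    have hyi : ¬ (clear G {x}).Reachable (b x i) y := hyx i
    have h1 : (clear G {y}).Reachable (b x i) w :=
      clear_singleton_reachable_of_not_reachable hw hyi
    have h2 : (clear G {y}).Adj x (b x i) :=
      ⟨(hb x hx).1 i, hne, by rintro rfl; exact hyi .rfl⟩
    exact (SimpleGraph.Reachable.trans hw' h1.symm).trans h2.symm.reachable
  · intro x hx i
    exact exists_mem_boundary (clear_le G {x}) hB (hB x (hTB hx) _ ((hb x hx).1 i))
      ((hb x hx).2.1 i)

/-- `x` is an end-vertex of degree at most one in an infinite component. -/
def IsTip (G : SimpleGraph V) (x : V) : Prop := InfAt G x ∧ (G.neighborSet x).encard ≤ 1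

theorem isPath_encard_internal {u v w : V} (p : G.Walk u v) (hp : p.IsPath)
    (hw : w ∈ p.support) (hwu : w ≠ u) (hwv : w ≠ v) :
    (p.toSubgraph.neighborSet w).encard = 2 := by
  obtain ⟨n, rfl, hn⟩ := SimpleGraph.Walk.mem_support_iff_exists_getVert.1 hw
  have h0 : n ≠ 0 := by rintro rfl; simp at hwu
  have h1 : n < p.length := lt_of_le_of_ne hn (by rintro rfl; simp at hwv)
  have h2 := hp.ncard_neighborSet_toSubgraph_internal_eq_two h0 h1
  rw [← Set.Finite.cast_ncard_eq p.finite_neighborSet_toSubgraph, h2]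
  rfl

theorem isPath_encard_start {u v : V} (p : G.Walk u v) (hp : p.IsPath) (huv : u ≠ v) :
    (p.toSubgraph.neighborSet u).encard = 1 := by
  rw [hp.neighborSet_toSubgraph_startpoint (SimpleGraph.Walk.not_nil_of_ne huv)]
  exact Set.encard_singleton _

theorem isPath_encard_end {u v : V} (p : G.Walk u v) (hp : p.IsPath) (huv : u ≠ v) :
    (p.toSubgraph.neighborSet v).encard = 1 := by
  rw [hp.neighborSet_toSubgraph_endpoint (SimpleGraph.Walk.not_nil_of_ne huv)]
  exact Set.encard_singleton _

/-- If all degrees are at most two, an infinite component has at most one tip. -/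
theorem IsTip.eq_of_reachable (hdeg : ∀ v, (G.neighborSet v).encard ≤ 2) {x y : V}
    (hx : IsTip G x) (hy : IsTip G y) (hxy : G.Reachable x y) : x = y := by
  classical
  by_contra hne
  obtain ⟨p, hp⟩ := hxy.exists_isPath
  -- The path uses up all edges of `G` at its vertices, one at each tip and two inside. Its support
  -- is therefore closed under adjacency, and the component would be finite.
  refine hx.1 (p.support.finite_toSet.subset fun v hv => ?_)
  refine reachable_induction (P := fun v => v ∈ p.support) hv p.start_mem_support ?_
  intro u w _ hu hadj
  have hsub : p.toSubgraph.neighborSet u ⊆ G.neighborSet u := p.toSubgraph.neighborSet_subset u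
  have hle : (G.neighborSet u).encard ≤ (p.toSubgraph.neighborSet u).encard := by
    by_cases hux : u = x
    · subst hux; rw [isPath_encard_start p hp hne]; exact hx.2
    by_cases huy : u = y
    · subst huy; rw [isPath_encard_end p hp hne]; exact hy.2
    · rw [isPath_encard_internal p hp hu hux huy]; exact hdeg u
  have heq := Set.Finite.eq_of_subset_of_encard_le
    p.finite_neighborSet_toSubgraph hsub hle
  have hw : w ∈ p.toSubgraph.neighborSet u := heq ▸ hadj
  exact SimpleGraph.Walk.mem_verts_toSubgraph p |>.1 (p.toSubgraph.edge_vert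
    (SimpleGraph.Subgraph.Adj.symm hw))

/-- Each tip is sent to a boundary point of its infinite component; this is injective because a
component has at most one tip. -/
theorem card_tip_le [DecidableEq V] (hdeg : ∀ v, (G.neighborSet v).encard ≤ 2)
    {B B' T : Finset V} (hB : ∀ x ∈ B, ∀ y, G.Adj x y → y ∈ B ∨ y ∈ B') (hTB : T ⊆ B)
    (hT : ∀ x ∈ T, IsTip G x) : T.card ≤ B'.card := by
  have h : ∀ x, ∃ v, x ∈ T → v ∈ B' ∧ G.Reachable x v := by
    intro x
    by_cases hx : x ∈ T
    · obtain ⟨v, hv, hr⟩ := exists_mem_boundary le_rfl hB (.inl (hTB hx)) (hT x hx).1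
      exact ⟨v, fun _ => ⟨hv, hr⟩⟩
    · exact ⟨x, fun h => absurd h hx⟩
  choose f hf using h
  refine Finset.card_le_card_of_injOn f (fun x hx => (hf x hx).1) fun x hx y hy hxy => ?_
  exact (hT x hx).eq_of_reachable hdeg (hT y hy)
    ((hf x hx).2.trans (hxy ▸ (hf y hy).2.symm))

end Graph

/-! ### Finite modifications that respect the degree constraint. -/

section Edit

variable {V : Type*} {G G' H L : SimpleGraph V}

/-- `G'` is a subgraph of `L` with all degrees at most `k` that agrees with `G` away from a finite
set of vertices. -/
def IsEdit (L : SimpleGraph V) (k : ℕ) (G G' : SimpleGraph V) : Prop :=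
  G' ≤ L ∧ (∀ v, (G'.neighborSet v).encard ≤ k) ∧
    ∃ S : Set V, S.Finite ∧ ∀ a b, a ∉ S → b ∉ S → (G.Adj a b ↔ G'.Adj a b)

theorem encard_neighborSet_mono (hle : G ≤ G') (v : V) :
    (G.neighborSet v).encard ≤ (G'.neighborSet v).encard :=
  Set.encard_le_encard fun _ hw => hle hw

theorem isEdit_clear {k : ℕ} (hGL : G ≤ L) (hdeg : ∀ v, (G.neighborSet v).encard ≤ k)
    {S : Set V} (hS : S.Finite) : IsEdit L k G (clear G S) :=
  ⟨(clear_le G S).trans hGL, fun v => (encard_neighborSet_mono (clear_le G S) v).trans (hdeg v),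
    S, hS, fun _ _ ha hb => ⟨fun h => ⟨h, ha, hb⟩, fun h => h.1⟩⟩

/-- When finitely many vertices are removed from a locally finite graph, an infinite component
that meets the removed set leaves an infinite component next to it. -/
theorem InfAt.exists_clear (hfin : ∀ v, (G.neighborSet v).Finite) {S : Set V} (hS : S.Finite)
    {u : V} (hu : u ∈ S) (h : InfAt G u) :
    ∃ b y, y ∈ S ∧ b ∉ S ∧ G.Adj b y ∧ InfAt (clear G S) b ∧ G.Reachable u b := by
  by_contra! hno
  -- The finite outer boundary of `S` in the component. Every vertex of the component is in `S` or
  -- connected to `N` off `S`, so some point of `N` must keep an infinite component.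
  set N : Set V := {b | b ∉ S ∧ G.Reachable u b ∧ ∃ y ∈ S, G.Adj b y} with hN
  have hNfin : N.Finite := by
    refine (hS.biUnion fun y _ => hfin y).subset ?_
    rintro b ⟨_, _, y, hy, hby⟩
    exact Set.mem_biUnion hy hby.symm
  refine h ((hS.union (hNfin.biUnion (t := fun b => {v | (clear G S).Reachable b v})
    fun b hb => ?_)).subset ?_)
  · obtain ⟨hbS, hr, y, hy, hby⟩ := hb
    by_contra hinf
    exact hno b y hy hbS hby hinf hr
  · intro v hv
    by_cases hvS : v ∈ S
    · exact .inl hvS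
    · obtain ⟨b, y, hy, hb, hby, hr⟩ := exists_adj_of_reachable (SimpleGraph.Reachable.symm hv)
        hvS hu
      exact .inr (Set.mem_biUnion (show b ∈ N from ⟨hb,
        SimpleGraph.Reachable.trans hv (hr.mono (clear_le _ _)), y, hy, hby⟩) hr.symm)

theorem InfAt.exists_infAt_clear (hfin : ∀ v, (G.neighborSet v).Finite) {S : Set V}
    (hS : S.Finite) {u : V} (h : InfAt G u) :
    ∃ b, InfAt (clear G S) b ∧ G.Reachable u b := by
  by_cases hmeet : ∃ x ∈ S, G.Reachable u x
  · obtain ⟨x, hx, hux⟩ := hmeet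
    obtain ⟨b, _, _, _, _, hb, hxb⟩ := (h.of_reachable hux).exists_clear hfin hS hx
    exact ⟨b, hb, hux.trans hxb⟩
  · push Not at hmeet
    refine ⟨u, Set.Infinite.mono (fun v hv => ?_) h, .rfl⟩
    refine reachable_induction (P := fun v => (clear G S).Reachable u v) hv .rfl ?_
    intro x y hx ih hadj
    exact ih.trans (SimpleGraph.Adj.reachable ⟨hadj, fun h => hmeet x h hx,
      fun h => hmeet y h (hx.trans hadj.reachable)⟩)

/-- Paths in `L` from a common point `z ∈ S` to points `d i` just outside `S`, disjoint away from
`z` and running inside `S`, whose last steps are edges of `G`. -/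
structure Pod (L G : SimpleGraph V) (S : Set V) (ι : Type*) where
  z : V
  d : ι → V
  p : ∀ i, L.Walk z (d i)
  z_mem : z ∈ S
  d_not_mem : ∀ i, d i ∉ S
  isPath : ∀ i, (p i).IsPath
  support : ∀ i, ∀ v ∈ (p i).support, v = d i ∨ v ∈ S
  disjoint : ∀ i j, i ≠ j → ∀ v ∈ (p i).support, v ∈ (p j).support → v = z
  adj : ∀ i v, (p i).toSubgraph.Adj (d i) v → G.Adj (d i) v

namespace Pod

variable {S : Set V} {ι : Type*} (P : Pod L G S ι)

/-- The graph obtained from `G` by deleting all edges that touch `S` and inserting the paths of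
the pod. -/
def join : SimpleGraph V := clear G S ⊔ ⨆ i, (P.p i).toSubgraph.spanningCoe

theorem join_adj {a b : V} :
    P.join.Adj a b ↔ (clear G S).Adj a b ∨ ∃ i, (P.p i).toSubgraph.Adj a b := by
  simp [join]

theorem mem_support {i : ι} {a b : V} (h : (P.p i).toSubgraph.Adj a b) :
    a ∈ (P.p i).support :=
  SimpleGraph.Walk.mem_verts_toSubgraph _ |>.1 ((P.p i).toSubgraph.edge_vert h)

theorem join_le (hGL : G ≤ L) : P.join ≤ L := by
  intro a b h
  rcases P.join_adj.1 h with h | ⟨i, h⟩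
  · exact hGL h.1
  · exact h.adj_sub

theorem z_ne (i : ι) : P.z ≠ P.d i := fun h => P.d_not_mem i (h ▸ P.z_mem)

theorem join_adj_iff {a b : V} (ha : a ∉ S) (hb : b ∉ S) : G.Adj a b ↔ P.join.Adj a b := by
  refine ⟨fun h => P.join_adj.2 (.inl ⟨h, ha, hb⟩), fun h => ?_⟩
  rcases P.join_adj.1 h with h | ⟨i, h⟩
  · exact h.1
  · have h1 := (P.support i a (P.mem_support h)).resolve_right ha
    subst h1
    exact P.adj i b h

theorem clear_join : clear P.join S = clear G S := by
  ext a b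
  exact ⟨fun h => ⟨(P.join_adj_iff h.2.1 h.2.2).2 h.1, h.2⟩,
    fun h => ⟨(P.join_adj_iff h.2.1 h.2.2).1 h.1, h.2⟩⟩

theorem reachable_join (i : ι) : P.join.Reachable P.z (P.d i) := by
  let f : (P.p i).toSubgraph.coe →g P.join :=
    ⟨Subtype.val, fun h => P.join_adj.2 (.inr ⟨i, h⟩)⟩
  have hc := (P.p i).toSubgraph_connected.preconnected
    ⟨P.z, (P.p i).start_mem_verts_toSubgraph⟩ ⟨P.d i, (P.p i).end_mem_verts_toSubgraph⟩
  exact hc.map f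

/-- The centre has at most one edge per arm and inner points of arms have degree two. Outside `S` no
degree grows, since the last edge of each arm was already in `G`; this is why a pod has the field
`adj`. -/
theorem encard_join_le [Fintype ι] {k : ℕ} (hdeg : ∀ v, (G.neighborSet v).encard ≤ k)
    (hk : 2 ≤ k) (hι : Fintype.card ι ≤ k) (v : V) : (P.join.neighborSet v).encard ≤ k := by
  by_cases hv : v ∈ S
  · have hsub : ∀ w, P.join.Adj v w → ∃ i, (P.p i).toSubgraph.Adj v w := fun w hw =>
      (P.join_adj.1 hw).resolve_left fun h => h.2.1 hv
    by_cases hz : v = P.z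
    · subst hz
      refine (Set.encard_le_encard (t := Set.range fun i => (P.p i).snd) ?_).trans ?_
      · intro w hw
        obtain ⟨i, hi⟩ := hsub w hw
        have hi : w ∈ (P.p i).toSubgraph.neighborSet P.z := hi
        rw [(P.isPath i).neighborSet_toSubgraph_startpoint
          (SimpleGraph.Walk.not_nil_of_ne (P.z_ne i))] at hi
        exact ⟨i, hi.symm⟩
      · rw [← Set.image_univ]
        refine (Set.encard_image_le _ _).trans ?_
        rw [Set.encard_univ, ENat.card_eq_coe_fintype_card]
        exact_mod_cast hι
    · by_cases hi : ∃ i, v ∈ (P.p i).support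
      · obtain ⟨i, hi⟩ := hi
        refine (Set.encard_le_encard (t := (P.p i).toSubgraph.neighborSet v) ?_).trans ?_
        · intro w hw
          obtain ⟨j, hj⟩ := hsub w hw
          obtain rfl : i = j := by
            by_contra hij
            exact hz (P.disjoint i j hij v hi (P.mem_support hj))
          exact hj
        · rw [isPath_encard_internal _ (P.isPath i) hi hz
            (by rintro rfl; exact P.d_not_mem i hv)]
          exact_mod_cast hk
      · push Not at hi
        have : P.join.neighborSet v = ∅ := by
          ext w
          simp only [SimpleGraph.mem_neighborSet, Set.mem_empty_iff_false, iff_false]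
          intro hw
          obtain ⟨j, hj⟩ := hsub w hw
          exact hi j (P.mem_support hj)
        simp [this]
  · refine (Set.encard_le_encard fun w hw => ?_).trans (hdeg v)
    rcases P.join_adj.1 hw with h | ⟨i, h⟩
    · exact h.1
    · have h1 := (P.support i v (P.mem_support h)).resolve_right hv
      subst h1
      exact P.adj i w h

theorem isEdit_join [Fintype ι] {k : ℕ} (hGL : G ≤ L) (hdeg : ∀ v, (G.neighborSet v).encard ≤ k)
    (hk : 2 ≤ k) (hι : Fintype.card ι ≤ k) (hS : S.Finite) : IsEdit L k G P.join :=
  ⟨P.join_le hGL, P.encard_join_le hdeg hk hι, S, hS, fun _ _ ha hb => P.join_adj_iff ha hb⟩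

/-- Arms meet only at the centre, so once it is removed an arm is attached to the component of its
own end and to nothing else. This separates the three branches at the centre. -/
theorem reachable_clear_join {i : ι} {v : V} (h : (clear P.join {P.z}).Reachable (P.d i) v)
    (hsep : ∀ i j, i ≠ j → ¬ (clear G S).Reachable (P.d i) (P.d j)) :
    (clear G S).Reachable (P.d i) v ∨ v ∈ (P.p i).support := by
  refine reachable_induction (P := fun v => (clear G S).Reachable (P.d i) v ∨ v ∈ (P.p i).support)
    h (.inl .rfl) ?_
  rintro x y - ih ⟨hadj, hx, hy⟩
  rcases P.join_adj.1 hadj with hadj | ⟨j, hj⟩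
  · refine .inl (SimpleGraph.Reachable.trans ?_ hadj.reachable)
    rcases ih with ih | ih
    · exact ih
    · rw [(P.support i x ih).resolve_right hadj.2.1]
  · refine .inr ?_
    obtain rfl : i = j := by
      by_contra hij
      rcases ih with ih | ih
      · have hxS : x ∉ S := not_mem_of_clear_reachable ih (P.d_not_mem i)
        rw [(P.support j x (P.mem_support hj)).resolve_right hxS] at ih
        exact hsep i j hij ih
      · exact hx (P.disjoint i j hij x ih (P.mem_support hj))
    exact P.mem_support hj.symm

theorem isTrif_join (P : Pod L G S (Fin 3)) (hinf : ∀ i, InfAt (clear G S) (P.d i))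
    (hsep : ∀ i j, i ≠ j → ¬ (clear G S).Reachable (P.d i) (P.d j)) : IsTrif P.join P.z := by
  have hle : clear G S ≤ clear P.join {P.z} := fun a b h =>
    ⟨P.join_adj.2 (.inl h), fun e => h.2.1 (by rw [Set.mem_singleton_iff.1 e]; exact P.z_mem),
      fun e => h.2.2 (by rw [Set.mem_singleton_iff.1 e]; exact P.z_mem)⟩
  have hex : ∀ i, ∃ b, P.join.Adj P.z b ∧ (clear P.join {P.z}).Reachable (P.d i) b := by
    intro i
    obtain ⟨b, y, hy, _, hadj, hr⟩ := exists_adj_of_reachable (S := {P.z})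
      (P.reachable_join i).symm (P.z_ne i).symm rfl
    obtain rfl : y = P.z := hy
    exact ⟨b, hadj.symm, hr⟩
  choose b hb hr using hex
  refine ⟨b, hb, fun i => ((hinf i).mono hle).of_reachable (hr i), fun i j hij h => ?_⟩
  rcases P.reachable_clear_join ((hr i).trans (h.trans (hr j).symm)) hsep with h | h
  · exact hsep i j hij h
  · rcases P.support i _ h with h | h
    · exact hsep i j hij (by rw [h])
    · exact P.d_not_mem j h

end Pod

/-- Any `ι`-indexed family of points in a connected graph can be joined to a common point by paths
that are disjoint away from that point. -/
def HasStars (V ι : Type*) : Prop :=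
  ∀ (H : SimpleGraph V) (y : ι → V), (∀ i j, H.Reachable (y i) (y j)) →
    ∃ (z : V) (q : ∀ i, H.Walk z (y i)), (∀ i, (q i).IsPath) ∧
      ∀ i j, i ≠ j → ∀ v ∈ (q i).support, v ∈ (q j).support → v = z

theorem hasStars_two (V : Type*) : HasStars V (Fin 2) := by
  intro H y hy
  obtain ⟨p, hp⟩ := (hy 0 1).exists_isPath
  refine ⟨y 0, Fin.cons .nil (Fin.cons p finZeroElim), ?_, ?_⟩
  · intro i
    fin_cases i
    · exact SimpleGraph.Walk.IsPath.nil
    · exact hp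
  · intro i j hij v hi hj
    fin_cases i <;> fin_cases j
    · exact absurd rfl hij
    · simpa using hi
    · simpa using hj
    · exact absurd rfl hij

theorem exists_first_hit {S : Set V} {a b : V} (w : H.Walk a b) (hb : b ∈ S) :
    ∃ z ∈ S, ∃ q : H.Walk a z, ∀ v ∈ q.support, v ∈ S → v = z := by
  induction w with
  | nil => exact ⟨_, hb, .nil, by simp⟩
  | @cons u c w hadj p ih =>
    by_cases hu : u ∈ S
    · exact ⟨u, hu, .nil, by simp⟩
    · obtain ⟨z, hz, q, hq⟩ := ih hb
      refine ⟨z, hz, .cons hadj q, fun v hv hvS => ?_⟩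
      rcases SimpleGraph.Walk.mem_support_iff _ |>.1 hv with rfl | hv
      · exact absurd hvS hu
      · exact hq v (by simpa using hv) hvS

/-- Join two of the points by a path and walk from the third until the path is first hit; the
hitting point is the centre, and it splits the path into two arms. -/
theorem hasStars_three (V : Type*) : HasStars V (Fin 3) := by
  classical
  intro H y hy
  obtain ⟨p, hp⟩ := (hy 0 1).exists_isPath
  obtain ⟨w⟩ := hy 2 0
  obtain ⟨z, hz, q, hq⟩ := exists_first_hit (S := {v | v ∈ p.support}) w p.start_mem_support
  have hz : z ∈ p.support := hz
  have hsub0 : ∀ v ∈ (p.takeUntil z hz).support, v ∈ p.support :=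
    fun v hv => p.support_takeUntil_subset_support hz hv
  have hsub1 : ∀ v ∈ (p.dropUntil z hz).support, v ∈ p.support :=
    fun v hv => p.support_dropUntil_subset_support hz hv
  have hq' : ∀ v ∈ q.bypass.support, v ∈ p.support → v = z :=
    fun v hv hvp => hq v (q.support_bypass_subset_support hv) hvp
  have h01 : ∀ v ∈ (p.takeUntil z hz).support, v ∈ (p.dropUntil z hz).support → v = z := by
    intro v h0 h1
    have hnd := hp.support_nodup
    rw [← p.take_spec hz, SimpleGraph.Walk.support_append] at hnd
    rcases SimpleGraph.Walk.mem_support_iff _ |>.1 h1 with h | h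
    · exact h
    · exact absurd h (List.disjoint_of_nodup_append hnd h0)
  have hrev : ∀ {v}, v ∈ q.bypass.reverse.support → v ∈ q.bypass.support := by simp
  refine ⟨z, Fin.cons (p.takeUntil z hz).reverse (Fin.cons (p.dropUntil z hz)
    (Fin.cons q.bypass.reverse finZeroElim)), ?_, ?_⟩
  · intro i
    fin_cases i
    · exact (hp.takeUntil hz).reverse
    · exact hp.dropUntil hz
    · exact q.bypass_isPath.reverse
  · intro i j hij v hi hj
    fin_cases i <;> fin_cases j
    · exact absurd rfl hij
    · exact h01 v (by simpa using hi) hj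
    · exact hq' v (hrev hj) (hsub0 v (by simpa using hi))
    · exact h01 v (by simpa using hj) hi
    · exact absurd rfl hij
    · exact hq' v (hrev hj) (hsub1 v hi)
    · exact hq' v (hrev hi) (hsub0 v (by simpa using hj))
    · exact hq' v (hrev hi) (hsub1 v hj)
    · exact absurd rfl hij

/-- `G` has an infinite component for each `i : ι`, all different. -/
def InfMany (ι : Type*) (G : SimpleGraph V) : Prop :=
  ∃ x : ι → V, (∀ i, InfAt G (x i)) ∧ ∀ i j, i ≠ j → ¬ G.Reachable (x i) (x j)

/-- The edges of `L` that run inside `S`. -/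
def within (L : SimpleGraph V) (S : Set V) : SimpleGraph V where
  Adj a b := L.Adj a b ∧ a ∈ S ∧ b ∈ S
  symm := ⟨fun _ _ h => ⟨h.1.symm, h.2.2, h.2.1⟩⟩
  loopless := ⟨fun x h => L.loopless.irrefl x h.1⟩

theorem within_le (L : SimpleGraph V) (S : Set V) : within L S ≤ L := fun _ _ h => h.1

theorem mem_of_mem_support_within {S : Set V} {a b : V} (w : (within L S).Walk a b)
    (ha : a ∈ S) {v : V} (hv : v ∈ w.support) : v ∈ S := by
  induction w with
  | nil => simp at hv; exact hv ▸ ha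
  | cons hadj p ih =>
    rcases SimpleGraph.Walk.mem_support_iff _ |>.1 hv with rfl | hv
    · exact ha
    · exact ih hadj.2.2 (by simpa using hv)

theorem within_reachable {S : Set V} {a b : V} (w : L.Walk a b) (hw : ∀ v ∈ w.support, v ∈ S)
    {v : V} (hv : v ∈ w.support) : (within L S).Reachable a v := by
  induction w with
  | nil => simp at hv; rw [hv]
  | @cons u c e hadj p ih =>
    rcases SimpleGraph.Walk.mem_support_iff _ |>.1 hv with rfl | hv
    · exact .rfl
    · have h : (within L S).Adj u c := ⟨hadj, hw u (by simp), hw c (by simp)⟩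
      exact h.reachable.trans (ih (fun v hv => hw v (by simp [hv])) (by simpa using hv))

/-- `S` is a finite union of walks in `L` linking the given components. Each component leaves `S` by
an edge of `G` to a point that stays in an infinite component; a star inside `S` is prolonged by
these edges. -/
theorem exists_pod {ι : Type*} [Fintype ι] [Nonempty ι] (hst : HasStars V ι)
    (hL : L.Preconnected) (hGL : G ≤ L) (hfin : ∀ v, (G.neighborSet v).Finite)
    (h : InfMany ι G) : ∃ (S : Set V) (P : Pod L G S ι), S.Finite ∧
      (∀ i, InfAt (clear G S) (P.d i)) ∧
      ∀ i j, i ≠ j → ¬ G.Reachable (P.d i) (P.d j) := by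
  classical
  obtain ⟨x, hinf, hsep⟩ := h
  let i₀ : ι := Classical.arbitrary ι
  let w : ∀ i, L.Walk (x i₀) (x i) := fun i => (hL (x i₀) (x i)).some
  set S : Set V := ⋃ i, {v | v ∈ (w i).support} with hS
  have hSfin : S.Finite := Set.finite_iUnion fun i => (w i).support.finite_toSet
  have hreach : ∀ v ∈ S, (within L S).Reachable (x i₀) v := by
    intro v hv
    obtain ⟨i, hi⟩ := Set.mem_iUnion.1 hv
    exact within_reachable (w i) (fun v hv => Set.mem_iUnion.2 ⟨i, hv⟩) hi
  have hxS : ∀ i, x i ∈ S := fun i => Set.mem_iUnion.2 ⟨i, (w i).end_mem_support⟩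
  have hd : ∀ i, ∃ b y, y ∈ S ∧ b ∉ S ∧ G.Adj b y ∧ InfAt (clear G S) b ∧ G.Reachable (x i) b :=
    fun i => (hinf i).exists_clear hfin hSfin (hxS i)
  choose d y hy hdS hadj hdinf hxd using hd
  have hdsep : ∀ i j, i ≠ j → ¬ G.Reachable (d i) (d j) := fun i j hij h =>
    hsep i j hij ((hxd i).trans (h.trans (hxd j).symm))
  obtain ⟨z, q, hq, hqd⟩ := hst (within L S) y fun i j =>
    (hreach _ (hy i)).symm.trans (hreach _ (hy j))
  have hzS : z ∈ S := by
    have := mem_of_mem_support_within (q i₀).reverse (hy i₀) (v := z) (by simp)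
    exact this
  have hqS : ∀ i, ∀ v ∈ (q i).support, v ∈ S := fun i v hv =>
    mem_of_mem_support_within (q i) hzS hv
  have hsupp : ∀ i v, v ∈ (((q i).mapLe (within_le L S)).concat (hGL (hadj i).symm)).support →
      v ∈ (q i).support ∨ v = d i := by
    intro i v hv
    simpa [SimpleGraph.Walk.support_concat] using hv
  have hpath : ∀ i, (((q i).mapLe (within_le L S)).concat (hGL (hadj i).symm)).IsPath := by
    intro i
    refine SimpleGraph.Walk.IsPath.concat ?_ ?_ _
    · exact (SimpleGraph.Walk.isPath_mapLe _).2 (hq i)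
    · simpa using fun h => hdS i (hqS i _ h)
  refine ⟨S, ⟨z, d, fun i => ((q i).mapLe (within_le L S)).concat (hGL (hadj i).symm), hzS, hdS,
    hpath, ?_, ?_, ?_⟩, hSfin, hdinf, hdsep⟩
  · intro i v hv
    rcases hsupp i v hv with h | h
    · exact .inr (hqS i v h)
    · exact .inl h
  · intro i j hij v hi hj
    rcases hsupp i v hi with hi | rfl
    · rcases hsupp j v hj with hj | rfl
      · exact hqd i j hij v hi hj
      · exact absurd (hqS i _ hi) (hdS j)
    · rcases hsupp j _ hj with hj | hj
      · exact absurd (hqS j _ hj) (hdS i)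
      · exact absurd (hj ▸ .rfl) (hdsep i j hij)
  · intro i v hv
    have hne : z ≠ d i := fun h => hdS i (h ▸ hzS)
    have hv : v ∈ (((q i).mapLe (within_le L S)).concat
      (hGL (hadj i).symm)).toSubgraph.neighborSet (d i) := hv
    rw [(hpath i).neighborSet_toSubgraph_endpoint (SimpleGraph.Walk.not_nil_of_ne hne)] at hv
    simp at hv
    exact hv ▸ hadj i

variable {k : ℕ}

theorem finite_neighborSet (hdeg : ∀ v, (G.neighborSet v).encard ≤ k) (v : V) :
    (G.neighborSet v).Finite := Set.finite_of_encard_le_coe (hdeg v)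

theorem exists_isEdit_isTrif (hL : L.Preconnected) (hGL : G ≤ L)
    (hdeg : ∀ v, (G.neighborSet v).encard ≤ k) (hk : 3 ≤ k) (h : InfMany (Fin 3) G) :
    ∃ G', IsEdit L k G G' ∧ ∃ z, IsTrif G' z := by
  obtain ⟨S, P, hS, hinf, hsep⟩ :=
    exists_pod (hasStars_three V) hL hGL (finite_neighborSet hdeg) h
  exact ⟨P.join, P.isEdit_join hGL hdeg (by omega) (by simpa using hk) hS, P.z,
    P.isTrif_join hinf fun i j hij h => hsep i j hij (h.mono (clear_le G S))⟩

/-- If there are two infinite components, then a finite edit has at least three or at most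
one. -/
theorem exists_isEdit_infMany_three_or (hL : L.Preconnected) (hGL : G ≤ L)
    (hdeg : ∀ v, (G.neighborSet v).encard ≤ k) (hk : 2 ≤ k) (h : InfMany (Fin 2) G) :
    ∃ G', IsEdit L k G G' ∧ (InfMany (Fin 3) G' ∨ ¬ InfMany (Fin 2) G') := by
  obtain ⟨S, P, hS, hinf, hsep⟩ :=
    exists_pod (hasStars_two V) hL hGL (finite_neighborSet hdeg) h
  have hsep' : ¬ (clear G S).Reachable (P.d 0) (P.d 1) := fun h =>
    hsep 0 1 (by decide) (h.mono (clear_le G S))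
  -- Deleting the edges at `S` may split the infinite components further; then the deletion itself
  -- is the edit.
  by_cases h3 : InfMany (Fin 3) (clear G S)
  · exact ⟨_, isEdit_clear hGL hdeg hS, .inl h3⟩
  have hedit := P.isEdit_join hGL hdeg hk (by simpa using hk) hS
  refine ⟨P.join, hedit, .inr ?_⟩
  -- An infinite component of the join contains an infinite component of `clear G S`. The only ones
  -- are those of `P.d 0` and `P.d 1`, and both are joined to the centre.
  have key : ∀ u, InfAt P.join u → P.join.Reachable u P.z := by
    intro u hu
    obtain ⟨b, hb, hub⟩ := hu.exists_infAt_clear (finite_neighborSet hedit.2.1) hS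
    rw [P.clear_join] at hb
    have hle : clear G S ≤ P.join := fun _ _ h => P.join_adj.2 (.inl h)
    refine hub.trans ?_
    by_cases h0 : (clear G S).Reachable (P.d 0) b
    · exact ((P.reachable_join 0).trans (h0.mono hle)).symm
    by_cases h1 : (clear G S).Reachable (P.d 1) b
    · exact ((P.reachable_join 1).trans (h1.mono hle)).symm
    refine absurd ⟨![P.d 0, P.d 1, b], ?_, ?_⟩ h3
    · intro i
      fin_cases i
      · exact hinf 0
      · exact hinf 1
      · exact hb
    · intro i j hij h
      fin_cases i <;> fin_cases j
      · exact hij rfl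
      · exact hsep' h
      · exact h0 h
      · exact hsep' h.symm
      · exact hij rfl
      · exact h1 h
      · exact h0 h.symm
      · exact h1 h.symm
      · exact hij rfl
  rintro ⟨x, hx, hne⟩
  exact hne 0 1 (by decide) ((key _ (hx 0)).trans (key _ (hx 1)).symm)

/-- Keep at `x` a single edge, to a neighbour whose component in `G - x` is infinite. -/
theorem exists_isEdit_isTip (hGL : G ≤ L) (hdeg : ∀ v, (G.neighborSet v).encard ≤ k)
    {x : V} (h : InfAt G x) : ∃ G', IsEdit L k G G' ∧ IsTip G' x := by
  obtain ⟨d, y, rfl : y = x, hd, hadj, hinf, -⟩ :=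
    h.exists_clear (finite_neighborSet hdeg) (Set.finite_singleton x) rfl
  let G' : SimpleGraph V :=
    { Adj := fun a b => G.Adj a b ∧ (a = y → b = d) ∧ (b = y → a = d)
      symm := ⟨fun _ _ h => ⟨h.1.symm, h.2.2, h.2.1⟩⟩
      loopless := ⟨fun x h => G.loopless.irrefl x h.1⟩ }
  have hle : G' ≤ G := fun _ _ h => h.1
  have hcl : clear G {y} ≤ G' := fun a b h =>
    ⟨h.1, fun e => absurd e h.2.1, fun e => absurd e h.2.2⟩
  have hdy : G'.Adj d y := ⟨hadj, fun e => absurd e hd, fun _ => rfl⟩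
  refine ⟨G', ⟨hle.trans hGL, fun v => (encard_neighborSet_mono hle v).trans (hdeg v), {y},
    Set.finite_singleton y, fun a b ha hb => ⟨fun h => hcl ⟨h, ha, hb⟩, fun h => h.1⟩⟩,
    (hinf.mono hcl).of_reachable hdy.reachable, ?_⟩
  rw [Set.encard_le_one_iff]
  intro a b ha hb
  rw [ha.2.1 rfl, hb.2.1 rfl]

end Edit

/-! ### The lattice, and resampling finitely many clocks. -/

section

variable {d : ℕ}

theorem lattice_finite_neighborSet (v : Fin d → ℤ) : ((lattice d).neighborSet v).Finite := by
  refine (Set.finite_Icc (v - 1) (v + 1)).subset fun w hw => ?_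
  have hw : ∑ i, |v i - w i| = 1 := hw
  have h : ∀ i, |v i - w i| ≤ 1 := fun i =>
    hw ▸ Finset.single_le_sum (f := fun i => |v i - w i|) (fun i _ => abs_nonneg _)
      (Finset.mem_univ i)
  constructor <;> intro i <;> have := abs_le.1 (h i) <;> simp <;> omega

theorem lattice_preconnected (d : ℕ) : (lattice d).Preconnected := by
  have key : ∀ (n : ℕ) (x y : Fin d → ℤ), ∑ i, |x i - y i| = n → (lattice d).Reachable x y := by
    intro n
    induction n with
    | zero =>
      intro x y h
      have h0 := (Finset.sum_eq_zero_iff_of_nonneg fun i _ => abs_nonneg (x i - y i)).1 h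
      have : x = y := funext fun i => by
        have := abs_eq_zero.1 (h0 i (Finset.mem_univ i)); omega
      rw [this]
    | succ n ih =>
      intro x y h
      obtain ⟨i, hi⟩ : ∃ i, x i ≠ y i := by
        by_contra! hxy
        simp [hxy] at h
        omega
      obtain ⟨c, hc1, hc2⟩ : ∃ c : ℤ, |x i - c| = 1 ∧ |c - y i| = |x i - y i| - 1 := by
        rcases lt_or_gt_of_ne hi with hlt | hlt
        · refine ⟨x i + 1, by simp, ?_⟩
          rw [abs_of_nonpos (by omega), abs_of_nonpos (by omega)]; omega
        · refine ⟨x i - 1, by simp, ?_⟩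
          rw [abs_of_nonneg (by omega), abs_of_nonneg (by omega)]; omega
      have hadj : (lattice d).Adj x (Function.update x i c) := by
        change ∑ j, |x j - Function.update x i c j| = 1
        rw [Finset.sum_eq_single i]
        · simpa using hc1
        · intro j _ hj; simp [hj]
        · simp
      refine hadj.reachable.trans (ih _ _ ?_)
      have h1 := Finset.add_sum_erase Finset.univ (fun j => |x j - y j|) (Finset.mem_univ i)
      have h2 := Finset.add_sum_erase Finset.univ (fun j => |Function.update x i c j - y j|)
        (Finset.mem_univ i)
      have h3 : ∑ j ∈ Finset.univ.erase i, |Function.update x i c j - y j| =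
          ∑ j ∈ Finset.univ.erase i, |x j - y j| :=
        Finset.sum_congr rfl fun j hj => by simp [Finset.ne_of_mem_erase hj]
      simp only [Function.update_self] at h2
      rw [← h2, h3, hc2]
      push_cast at h
      linarith
  intro x y
  exact key (∑ i, |x i - y i|).toNat x y
    (Int.toNat_of_nonneg (Finset.sum_nonneg fun i _ => abs_nonneg _)).symm

theorem finite_edges_at (v : Fin d → ℤ) : {e : Edge d | v ∈ e.1}.Finite := by
  have := (lattice_finite_neighborSet v).to_subtype
  refine (Set.finite_range fun w : (lattice d).neighborSet v =>
    (⟨s(v, w), w.2⟩ : Edge d)).subset ?_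
  rintro ⟨e, he⟩ hv
  obtain ⟨w, rfl⟩ := Sym2.mem_iff_exists.1 hv
  exact ⟨⟨w, he⟩, rfl⟩

theorem finite_edges_meeting {S : Set (Fin d → ℤ)} (hS : S.Finite) :
    {e : Edge d | ∃ v ∈ S, v ∈ e.1}.Finite := by
  refine (hS.biUnion fun v _ => finite_edges_at v).subset ?_
  rintro e ⟨v, hv, hve⟩
  exact Set.mem_biUnion hv hve

theorem encard_edges_at {G : SimpleGraph (Fin d → ℤ)} (hG : G ≤ lattice d) (v : Fin d → ℤ) :
    {f : Edge d | v ∈ f.1 ∧ f.1 ∈ G.edgeSet}.encard = (G.neighborSet v).encard := by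
  have h1 : (fun w => s(v, w)) '' G.neighborSet v =
      Subtype.val '' {f : Edge d | v ∈ f.1 ∧ f.1 ∈ G.edgeSet} := by
    ext e
    constructor
    · rintro ⟨w, hw, rfl⟩
      exact ⟨⟨s(v, w), hG hw⟩, ⟨Sym2.mem_mk_left v w, hw⟩, rfl⟩
    · rintro ⟨f, ⟨hv, hf⟩, rfl⟩
      obtain ⟨w, hw⟩ := Sym2.mem_iff_exists.1 hv
      rw [hw] at hf
      exact ⟨w, hf, hw.symm⟩
  rw [← Subtype.val_injective.encard_image, ← h1, Function.Injective.encard_image]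
  exact fun a b hab => Sym2.congr_right.1 hab

variable {k : ℕ} {U U' : Clocks d} {t : ℝ}

theorem openGraph_le : openGraph k U t ≤ lattice d := fun _ _ h => h.1

theorem mem_edgeSet_openGraph {e : Edge d} :
    e.1 ∈ (openGraph k U t).edgeSet ↔ IsOpen k U t e := by
  obtain ⟨e, he⟩ := e
  induction e with
  | _ x y => exact ⟨fun ⟨_, h⟩ => h, fun h => ⟨he, h⟩⟩

theorem not_succeeds_of_not_wellFounded (h : ¬ WellFounded (Earlier U)) (e : Edge d) :
    ¬ Succeeds k U e := by
  unfold Succeeds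
  rw [dif_neg h]
  exact id

/-- Otherwise no edge opens and clusters are single points. Hence almost sure well-foundedness need
not be proved separately. -/
theorem wellFounded_of_infAt {x : Fin d → ℤ} (h : InfAt (openGraph k U t) x) :
    WellFounded (Earlier U) := by
  by_contra hwf
  refine h ((Set.finite_singleton x).subset fun y hy => ?_)
  refine reachable_induction (P := fun y => y = x) hy rfl ?_
  rintro u w - - ⟨hadj, ho⟩
  exact absurd ho.2 (not_succeeds_of_not_wellFounded hwf _)

/-- Clocks strictly decrease along a descending chain, so the chain never repeats an edge and
eventually leaves `F`. -/
theorem wellFounded_earlier_of_eqOn {F : Set (Edge d)} (hF : F.Finite)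
    (h : WellFounded (Earlier U)) (heq : ∀ e ∉ F, U' e = U e) : WellFounded (Earlier U') := by
  rw [wellFounded_iff_isEmpty_descending_chain] at h ⊢
  refine ⟨fun ⟨f, hf⟩ => ?_⟩
  have hanti : StrictAnti fun n => U' (f n) := strictAnti_nat_of_succ_lt fun n => (hf n).2
  have hinj : Function.Injective f := fun a b hab => hanti.injective (by simp only [hab])
  obtain ⟨N, hN⟩ := (hF.preimage hinj.injOn).bddAbove
  refine h.false ⟨fun n => f (N + 1 + n), fun n => ?_⟩
  have hout : ∀ m, f (N + 1 + m) ∉ F := fun m hm => by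
    have := hN (show N + 1 + m ∈ f ⁻¹' F from hm)
    omega
  obtain ⟨h1, h2⟩ := hf (N + 1 + n)
  refine ⟨h1, ?_⟩
  have h3 := heq _ (hout n)
  have h4 := heq _ (hout (n + 1))
  change U (f (N + 1 + n + 1)) < U (f (N + 1 + n))
  rw [← h3]
  rw [← add_assoc] at h4
  rw [← h4]
  exact h2

/-- Resampling the clocks on a finite set `F` of edges turns the open graph into a prescribed graph
`G'`, if the two graphs agree off `F`, and off `F` no closed edge is adjacent to an open edge
of `F`. -/
theorem openGraph_eq_of_resample {G' : SimpleGraph (Fin d → ℤ)} {F : Set (Edge d)}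
    (hF : F.Finite) (hwf : WellFounded (Earlier U)) (hle : G' ≤ lattice d)
    (hdeg : ∀ v, (G'.neighborSet v).encard ≤ k)
    (h1 : ∀ e ∉ F, (IsOpen k U t e ↔ e.1 ∈ G'.edgeSet))
    (h2 : ∀ e ∉ F, ¬ IsOpen k U t e → ∀ f ∈ F, (∃ v, v ∈ f.1 ∧ v ∈ e.1) → ¬ IsOpen k U t f)
    (heq : ∀ e ∉ F, U' e = U e) (hpat : ∀ e ∈ F, ((U' e : ℝ) ≤ t ↔ e.1 ∈ G'.edgeSet)) :
    openGraph k U' t = G' := by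
  have hwf' := wellFounded_earlier_of_eqOn hF hwf heq
  have hle_of : ∀ e : Edge d, e.1 ∈ G'.edgeSet → (U' e : ℝ) ≤ t := by
    intro e he
    by_cases heF : e ∈ F
    · exact (hpat e heF).2 he
    · rw [heq e heF]
      exact ((h1 e heF).2 he).1
  have key : ∀ e : Edge d, (U' e : ℝ) ≤ t → (Succeeds k U' e ↔ e.1 ∈ G'.edgeSet) := by
    intro e
    induction e using hwf'.induction with
    | _ e ih =>
      intro het
      have ih' : ∀ f : Edge d, (∃ v, v ∈ f.1 ∧ v ∈ e.1) → U' f < U' e →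
          (Succeeds k U' f ↔ f.1 ∈ G'.edgeSet) := fun f hv hf =>
        ih f ⟨hv, hf⟩ ((Subtype.coe_lt_coe.2 hf).le.trans het)
      constructor
      · intro hs
        by_contra he
        have heF : e ∉ F := fun h => he ((hpat e h).1 het)
        have hclosed : ¬ IsOpen k U t e := fun h => he ((h1 e heF).1 h)
        have het' : (U e : ℝ) ≤ t := heq e heF ▸ het
        -- The earlier open neighbours of the closed edge `e` lie outside `F` by `h2`, keep their
        -- clocks and succeed again by induction. If `e` succeeds now, it therefore succeeded
        -- before.
        refine hclosed ⟨het', (succeeds_iff k U hwf e).2 fun v hv => ?_⟩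
        refine lt_of_le_of_lt (Set.encard_le_encard ?_) ((succeeds_iff k U' hwf' e).1 hs v hv)
        rintro f ⟨hvf, hfe, hsf⟩
        have hfo : IsOpen k U t f := ⟨(Subtype.coe_lt_coe.2 hfe).le.trans het', hsf⟩
        have hfF : f ∉ F := fun h => h2 e heF hclosed f h ⟨v, hvf, hv⟩ hfo
        have hlt : U' f < U' e := by rw [heq f hfF, heq e heF]; exact hfe
        exact ⟨hvf, hlt, (ih' f ⟨v, hvf, hv⟩ hlt).2 ((h1 f hfF).1 hfo)⟩
      · intro he
        refine (succeeds_iff k U' hwf' e).2 fun v hv => ?_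
        -- All these edges belong to `G'`, which has at most `k` edges at `v`; setting `e` aside
        -- leaves fewer than `k`.
        have hsub : insert e {f : Edge d | v ∈ f.1 ∧ U' f < U' e ∧ Succeeds k U' f} ⊆
            {f : Edge d | v ∈ f.1 ∧ f.1 ∈ G'.edgeSet} := by
          rintro f (rfl | ⟨hvf, hlt, hsf⟩)
          · exact ⟨hv, he⟩
          · exact ⟨hvf, (ih' f ⟨v, hvf, hv⟩ hlt).1 hsf⟩
        have hcard := (Set.encard_le_encard hsub).trans ((encard_edges_at hle v).le.trans (hdeg v))
        rw [Set.encard_insert_of_notMem (fun h => lt_irrefl _ h.2.1)] at hcard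
        exact (ENat.add_one_le_iff (fun htop => by simp [htop] at hcard)).1 hcard
  ext x y
  constructor
  · rintro ⟨h, ho⟩
    exact (key ⟨s(x, y), h⟩ ho.1).1 ho.2
  · intro h
    have hm : (⟨s(x, y), hle h⟩ : Edge d).1 ∈ G'.edgeSet := h
    exact ⟨hle h, hle_of _ hm, (key _ (hle_of _ hm)).2 hm⟩

/-- Every edit of the open graph is produced by all clocks that follow a certain pattern on a
certain finite set of edges. -/
theorem exists_resample {G' : SimpleGraph (Fin d → ℤ)} (hwf : WellFounded (Earlier U))
    (hG' : IsEdit (lattice d) k (openGraph k U t) G') :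
    ∃ F : Finset (Edge d), ∃ A : Set (Edge d), ∀ U' : Clocks d, (∀ e ∉ F, U' e = U e) →
      (∀ e ∈ F, ((U' e : ℝ) ≤ t ↔ e ∈ A)) → openGraph k U' t = G' := by
  obtain ⟨hle, hdeg, S, hS, hdiff⟩ := hG'
  set N : Set (Fin d → ℤ) := S ∪ ⋃ v ∈ S, (lattice d).neighborSet v with hN
  have hNfin : N.Finite := hS.union (hS.biUnion fun v _ => lattice_finite_neighborSet v)
  -- An open edge of `F` is missing from `G'`, hence touches `S`; a closed edge adjacent to it meets
  -- `N` and so is in `F`. This is the separation that `openGraph_eq_of_resample` requires.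
  set F : Set (Edge d) := {e | (∃ v ∈ N, v ∈ e.1) ∧
    ¬ (IsOpen k U t e ∧ e.1 ∈ G'.edgeSet)} with hFdef
  have hF : F.Finite := (finite_edges_meeting hNfin).subset fun e he => he.1
  have hdiff' : ∀ e : Edge d, (∀ v ∈ S, v ∉ e.1) → (IsOpen k U t e ↔ e.1 ∈ G'.edgeSet) := by
    rintro ⟨e, he⟩ hv
    rw [← mem_edgeSet_openGraph]
    induction e with
    | _ x y => exact hdiff x y (fun h => hv x h (by simp)) (fun h => hv y h (by simp))
  have hSN : ∀ v ∈ S, ∀ e : Edge d, v ∈ e.1 → ∀ w ∈ e.1, w ∈ N := by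
    rintro v hv ⟨e, he⟩ hve w hw
    obtain ⟨u, rfl⟩ := Sym2.mem_iff_exists.1 hve
    rcases Sym2.mem_iff.1 hw with rfl | rfl
    · exact .inl hv
    · exact .inr (Set.mem_biUnion hv he)
  refine ⟨hF.toFinset, {e | e.1 ∈ G'.edgeSet}, fun U' heq hpat => ?_⟩
  refine openGraph_eq_of_resample hF hwf hle hdeg ?_ ?_
    (fun e he => heq e (by simpa using he)) (fun e he => hpat e (by simpa using he))
  · intro e he
    by_cases hb : IsOpen k U t e ∧ e.1 ∈ G'.edgeSet
    · exact iff_of_true hb.1 hb.2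
    · exact hdiff' e fun v hv hve => he ⟨⟨v, .inl hv, hve⟩, hb⟩
  · rintro e he hclosed f hf ⟨v, hvf, hve⟩ hfo
    have hfG' : f.1 ∉ G'.edgeSet := fun h => hf.2 ⟨hfo, h⟩
    obtain ⟨u, hu, huf⟩ : ∃ u ∈ S, u ∈ f.1 := by
      by_contra! hno
      exact hfG' ((hdiff' f hno).1 hfo)
    exact he ⟨⟨v, hSN u hu f huf v hvf, hve⟩, fun h => hclosed h.1⟩

end

section

/-! ### Measurability of graph properties. -/

section Random

variable {V Ω : Type*} [MeasurableSpace Ω] {G : Ω → SimpleGraph V}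

theorem measurable_const_prop (p : Prop) : Measurable fun _ : Ω => p := measurable_const

theorem measurable_clear (hG : ∀ a b, Measurable fun ω => (G ω).Adj a b) (S : Set V) (a b : V) :
    Measurable fun ω => (clear (G ω) S).Adj a b :=
  (hG a b).and (measurable_const_prop (a ∉ S ∧ b ∉ S))

variable [Countable V]

theorem measurable_reachable (hG : ∀ a b, Measurable fun ω => (G ω).Adj a b) (a b : V) :
    Measurable fun ω => (G ω).Reachable a b := by
  have key : ∀ (n : ℕ) (a b : V), Measurable fun ω => ∃ p : (G ω).Walk a b, p.length = n := by
    intro n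
    induction n with
    | zero =>
      intro a b
      simp only [SimpleGraph.Walk.exists_length_eq_zero_iff]
      exact measurable_const
    | succ n ih =>
      intro a b
      have : ∀ ω, (∃ p : (G ω).Walk a b, p.length = n + 1) ↔
          ∃ c, (G ω).Adj a c ∧ ∃ p : (G ω).Walk c b, p.length = n := by
        intro ω
        constructor
        · rintro ⟨_ | ⟨h, p⟩, hp⟩
          · simp at hp
          · exact ⟨_, h, p, by simpa using hp⟩
        · rintro ⟨c, h, p, hp⟩
          exact ⟨.cons h p, by simp [hp]⟩
      simp only [this]
      exact Measurable.exists fun c => (hG a c).and (ih c b)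
  have : ∀ ω, (G ω).Reachable a b ↔ ∃ n, ∃ p : (G ω).Walk a b, p.length = n :=
    fun ω => ⟨fun ⟨p⟩ => ⟨_, p, rfl⟩, fun ⟨_, p, _⟩ => ⟨p⟩⟩
  simp only [this]
  exact Measurable.exists fun n => key n a b

theorem measurable_infAt (hG : ∀ a b, Measurable fun ω => (G ω).Adj a b) (a : V) :
    Measurable fun ω => InfAt (G ω) a := by
  have : ∀ ω, InfAt (G ω) a ↔ ∀ F : Finset V, ∃ y, y ∉ F ∧ (G ω).Reachable a y := by
    intro ω
    constructor
    · intro h F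
      obtain ⟨y, hy, hyF⟩ := Set.Infinite.exists_notMem_finset h F
      exact ⟨y, hyF, hy⟩
    · intro h hfin
      obtain ⟨y, hy, hr⟩ := h hfin.toFinset
      exact hy (by simpa using hr)
  simp only [this]
  exact Measurable.forall fun F => Measurable.exists fun y =>
    (measurable_const_prop _).and (measurable_reachable hG a y)

theorem measurable_isTrif (hG : ∀ a b, Measurable fun ω => (G ω).Adj a b) (x : V) :
    Measurable fun ω => IsTrif (G ω) x :=
  Measurable.exists fun a => (Measurable.forall fun i => hG x (a i)).and
    ((Measurable.forall fun i => measurable_infAt (measurable_clear hG {x}) (a i)).and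
    (Measurable.forall fun i => Measurable.forall fun j => (measurable_const_prop _).imp
      (measurable_reachable (measurable_clear hG {x}) (a i) (a j)).not))

theorem measurable_infMany {ι : Type*} [Finite ι]
    (hG : ∀ a b, Measurable fun ω => (G ω).Adj a b) : Measurable fun ω => InfMany ι (G ω) :=
  Measurable.exists fun x => (Measurable.forall fun i => measurable_infAt hG (x i)).and
    (Measurable.forall fun i => Measurable.forall fun j => (measurable_const_prop _).imp
      (measurable_reachable hG (x i) (x j)).not)

theorem measurable_encard_lt {p : V → Ω → Prop} (hp : ∀ v, Measurable (p v)) (k : ℕ) :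
    Measurable fun ω => {v | p v ω}.encard < k := by
  have : ∀ ω, {v | p v ω}.encard < k ↔ ¬ ∃ F : Finset V, F.card = k ∧ ∀ v, v ∈ F → p v ω := by
    intro ω
    rw [← not_le, not_iff_not]
    constructor
    · intro h
      obtain ⟨T, hT, hTk⟩ := Set.exists_subset_encard_eq h
      have hfin : T.Finite := Set.finite_of_encard_eq_coe hTk
      refine ⟨hfin.toFinset, ?_, fun v hv => hT (by simpa using hv)⟩
      rw [hfin.encard_eq_coe_toFinset_card] at hTk
      exact_mod_cast hTk
    · rintro ⟨F, rfl, hF⟩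
      rw [← Set.encard_coe_eq_coe_finsetCard]
      exact Set.encard_le_encard hF
  simp only [this]
  exact (Measurable.exists fun F => (measurable_const_prop _).and
    (Measurable.forall fun v => (measurable_const_prop _).imp (hp v))).not

theorem measurable_isTip (hG : ∀ a b, Measurable fun ω => (G ω).Adj a b) (x : V) :
    Measurable fun ω => IsTip (G ω) x := by
  have : ∀ ω, ((G ω).neighborSet x).encard ≤ 1 ↔ {v | (G ω).Adj x v}.encard < (2 : ℕ) :=
    fun ω => (ENat.lt_add_one_iff (n := 1) (by simp)).symm
  refine (measurable_infAt hG x).and ?_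
  simp only [this]
  exact measurable_encard_lt (fun v => hG x v) 2

end Random

variable {d k : ℕ} {t : ℝ}

/-! ### Measurability of the open graph. -/

section Measurability

/-- The height of `e` in the relation `Earlier U` is less than `n`. -/
def HeightLT (U : Clocks d) : ℕ → Edge d → Prop
  | 0, _ => False
  | n + 1, e => ∀ f, Earlier U f e → HeightLT U n f

/-- The `n`-th iterate of the recursion that defines `Succeeds`. -/
def stage (k : ℕ) (U : Clocks d) : ℕ → Edge d → Prop
  | 0, _ => False
  | n + 1, e => ∀ v, v ∈ e.1 → {f : Edge d | v ∈ f.1 ∧ U f < U e ∧ stage k U n f}.encard < k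

theorem HeightLT.mono {U : Clocks d} {m n : ℕ} {e : Edge d} (h : HeightLT U m e) (hmn : m ≤ n) :
    HeightLT U n e := by
  induction m generalizing n e with
  | zero => exact h.elim
  | succ m ih =>
    obtain ⟨n, rfl⟩ : ∃ n', n = n' + 1 := ⟨n - 1, by omega⟩
    exact fun f hf => ih (h f hf) (by omega)

/-- An edge has finitely many neighbours, so heights are finite, and well-foundedness becomes a
countable combination of measurable conditions. -/
theorem wellFounded_earlier_iff (U : Clocks d) :
    WellFounded (Earlier U) ↔ ∀ e, ∃ n, HeightLT U n e := by
  constructor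
  · intro h e
    induction e using h.induction with
    | _ e ih =>
      have hfin : {f : Edge d | Earlier U f e}.Finite :=
        (finite_edges_meeting (S := {v | v ∈ e.1}) (by
          classical
          exact (e.1.toFinset.finite_toSet).subset fun v hv => by simpa using hv)).subset
          fun f hf => hf.1.imp fun v hv => ⟨hv.2, hv.1⟩
      choose! n hn using ih
      obtain ⟨N, hN⟩ := (hfin.image n).bddAbove
      exact ⟨N + 1, fun f hf => (hn f hf).mono (hN ⟨f, hf, rfl⟩)⟩
  · intro h
    refine ⟨fun e => ?_⟩
    obtain ⟨n, hn⟩ := h e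
    induction n generalizing e with
    | zero => exact hn.elim
    | succ n ih => exact ⟨_, fun f hf => ih f (hn f hf)⟩

theorem stage_iff_succeeds {U : Clocks d} (h : WellFounded (Earlier U)) {n : ℕ} {e : Edge d}
    (hn : HeightLT U n e) : stage k U n e ↔ Succeeds k U e := by
  induction n generalizing e with
  | zero => exact hn.elim
  | succ n ih =>
    rw [succeeds_iff k U h]
    refine forall₂_congr fun v hv => ?_
    have : {f : Edge d | v ∈ f.1 ∧ U f < U e ∧ stage k U n f} =
        {f : Edge d | v ∈ f.1 ∧ U f < U e ∧ Succeeds k U f} := by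
      ext f
      exact and_congr_right fun hvf => and_congr_right fun hlt => ih (hn f ⟨⟨v, hvf, hv⟩, hlt⟩)
    rw [this]

theorem succeeds_iff_exists_stage (U : Clocks d) (e : Edge d) :
    Succeeds k U e ↔ (∀ f, ∃ n, HeightLT U n f) ∧ ∃ n, HeightLT U n e ∧ stage k U n e := by
  by_cases h : WellFounded (Earlier U)
  · have h' := (wellFounded_earlier_iff U).1 h
    constructor
    · intro hs
      obtain ⟨n, hn⟩ := h' e
      exact ⟨h', n, hn, (stage_iff_succeeds h hn).2 hs⟩
    · rintro ⟨-, n, hn, hs⟩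
      exact (stage_iff_succeeds h hn).1 hs
  · exact iff_of_false (not_succeeds_of_not_wellFounded h e)
      fun hh => h ((wellFounded_earlier_iff U).2 hh.1)

theorem measurable_lt (e f : Edge d) : Measurable fun U : Clocks d => U e < U f :=
  measurableSet_setOfPred.1 (measurableSet_lt (measurable_pi_apply e) (measurable_pi_apply f))

theorem measurable_heightLT (n : ℕ) (e : Edge d) :
    Measurable fun U : Clocks d => HeightLT U n e := by
  induction n generalizing e with
  | zero => exact measurable_const
  | succ n ih =>
    exact Measurable.forall fun f => ((measurable_const_prop _).and (measurable_lt f e)).imp (ih f)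

theorem measurable_stage (n : ℕ) (e : Edge d) :
    Measurable fun U : Clocks d => stage k U n e := by
  induction n generalizing e with
  | zero => exact measurable_const
  | succ n ih =>
    have h1 : ∀ (v : Fin d → ℤ) (f : Edge d), Measurable fun U : Clocks d =>
        v ∈ f.1 ∧ U f < U e ∧ stage k U n f := by
      intro v f
      have h2 := (measurable_lt f e).and (ih f)
      exact (measurable_const_prop _).and h2
    have h : ∀ v : Fin d → ℤ, Measurable fun U : Clocks d =>
        {f : Edge d | v ∈ f.1 ∧ U f < U e ∧ stage k U n f}.encard < k := by
      intro v
      exact measurable_encard_lt (h1 v) k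
    exact Measurable.forall fun v => (measurable_const_prop (v ∈ e.1)).imp (h v)

theorem measurable_succeeds (e : Edge d) : Measurable fun U : Clocks d => Succeeds k U e := by
  simp only [succeeds_iff_exists_stage]
  exact (Measurable.forall fun f => Measurable.exists fun n => measurable_heightLT n f).and
    (Measurable.exists fun n => (measurable_heightLT n e).and (measurable_stage n e))

theorem measurable_isOpen (e : Edge d) : Measurable fun U : Clocks d => IsOpen k U t e :=
  (measurableSet_setOfPred.1 (measurableSet_le (measurable_subtype_coe.comp (measurable_pi_apply e))
    measurable_const)).and (measurable_succeeds e)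

theorem measurable_openGraph (x y : Fin d → ℤ) :
    Measurable fun U : Clocks d => (openGraph k U t).Adj x y := by
  by_cases h : (lattice d).Adj x y
  · have : ∀ U : Clocks d, (openGraph k U t).Adj x y ↔ IsOpen k U t ⟨s(x, y), h⟩ :=
      fun U => ⟨fun ⟨_, ho⟩ => ho, fun ho => ⟨h, ho⟩⟩
    simp only [this]
    exact measurable_isOpen _
  · have : ∀ U : Clocks d, ¬ (openGraph k U t).Adj x y := fun U ⟨h', _⟩ => h h'
    simp only [this]
    exact measurable_const

end Measurability

/-! ### Finite energy. -/

section Resample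

instance : IsProbabilityMeasure (clockMeasure d) := by
  unfold clockMeasure; infer_instance

open Classical in
/-- Replace the clocks on `F` by those of an independent copy. -/
def resample (F : Finset (Edge d)) (P : Clocks d × Clocks d) : Clocks d :=
  fun e => if e ∈ F then P.2 e else P.1 e

theorem measurable_resample (F : Finset (Edge d)) : Measurable (resample F) := by
  refine measurable_pi_iff.2 fun e => ?_
  unfold resample
  split_ifs
  · exact (measurable_pi_apply e).comp measurable_snd
  · exact (measurable_pi_apply e).comp measurable_fst

theorem measurePreserving_resample (F : Finset (Edge d)) :
    MeasurePreserving (resample F) ((clockMeasure d).prod (clockMeasure d)) (clockMeasure d) := by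
  classical
  refine ⟨measurable_resample F, Measure.eq_infinitePi _ fun s T hT => ?_⟩
  have hpre : resample F ⁻¹' (Set.pi s T) =
      (Set.pi ↑(s.filter (· ∉ F)) T) ×ˢ (Set.pi ↑(s.filter (· ∈ F)) T) := by
    ext ⟨U, V⟩
    simp only [Set.mem_preimage, Set.mem_pi, Set.mem_prod, Finset.coe_filter, Set.mem_ofPred_eq,
      Finset.mem_coe, resample]
    constructor
    · intro h
      exact ⟨fun e he => by simpa [he.2] using h e he.1, fun e he => by simpa [he.2] using h e he.1⟩
    · rintro ⟨h1, h2⟩ e he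
      split_ifs with hF
      · exact h2 e ⟨he, hF⟩
      · exact h1 e ⟨he, hF⟩
  rw [Measure.map_apply (measurable_resample F) (.pi s.countable_toSet fun i _ => hT i), hpre,
    Measure.prod_prod, clockMeasure, Measure.infinitePi_pi _ fun i _ => hT i,
    Measure.infinitePi_pi _ fun i _ => hT i, mul_comm,
    Finset.prod_filter_mul_prod_filter_not]

/-- Each of the finitely many clocks obeys its requirement with probability `t` or `1 - t`. -/
theorem clockMeasure_pattern_pos (ht0 : 0 < t) (ht1 : t < 1) (F : Finset (Edge d))
    (A : Set (Edge d)) : clockMeasure d {V | ∀ e ∈ F, ((V e : ℝ) ≤ t ↔ e ∈ A)} ≠ 0 := by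
  classical
  let τ : unitInterval := ⟨t, ht0.le, ht1.le⟩
  have : {V : Clocks d | ∀ e ∈ F, ((V e : ℝ) ≤ t ↔ e ∈ A)} =
      Set.pi F fun e => if e ∈ A then Set.Iic τ else Set.Ioi τ := by
    ext V
    refine forall₂_congr fun e he => ?_
    change _ ↔ V e ∈ if e ∈ A then Set.Iic τ else Set.Ioi τ
    split_ifs with h
    · simp only [h, iff_true]
      exact Iff.rfl
    · simp only [h, iff_false, not_le]
      exact Iff.rfl
  rw [this, clockMeasure, Measure.infinitePi_pi]
  · refine Finset.prod_ne_zero_iff.2 fun e _ => ?_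
    split_ifs
    · simpa [τ] using ht0
    · simpa [τ] using ht1
  · intro e _
    split_ifs
    · exact measurableSet_Iic
    · exact measurableSet_Ioi

/-- Finite energy: if the open graph almost surely does not have the property `Q`, then almost
surely no edit of it has this property. -/
theorem ae_forall_isEdit_not {Q : SimpleGraph (Fin d → ℤ) → Prop} (ht0 : 0 < t) (ht1 : t < 1)
    (hQ : ∀ᵐ U ∂clockMeasure d, ¬ Q (openGraph k U t)) :
    ∀ᵐ U ∂clockMeasure d, WellFounded (Earlier U) →
      ∀ G', IsEdit (lattice d) k (openGraph k U t) G' → ¬ Q G' := by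
  -- Resampling preserves the law, so Fubini applies for each `F`, and there are countably many `F`.
  -- An edit with `Q` would then force a pattern of positive probability into a null set.
  have h1 : ∀ᵐ U ∂clockMeasure d, ∀ F : Finset (Edge d), ∀ᵐ V ∂clockMeasure d,
      ¬ Q (openGraph k (resample F (U, V)) t) := by
    refine ae_all_iff.2 fun F => ?_
    exact Measure.ae_ae_of_ae_prod ((measurePreserving_resample F).quasiMeasurePreserving.ae hQ)
  filter_upwards [h1] with U hU hwf G' hG' hQ'
  obtain ⟨F, A, hFA⟩ := exists_resample hwf hG'
  refine clockMeasure_pattern_pos ht0 ht1 F A (measure_mono_null (fun V hV => ?_) (hU F))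
  have : openGraph k (resample F (U, V)) t = G' :=
    hFA _ (fun e he => by simp [resample, he]) (fun e he => by simpa [resample, he] using hV e he)
  simpa [this] using hQ'

end Resample

/-! ### Almost surely distinct clocks, and the resulting degree bound. -/

section Ties

theorem ae_ne_time (t : ℝ) : ∀ᵐ U ∂clockMeasure d, ∀ e, (U e : ℝ) ≠ t := by
  refine ae_all_iff.2 fun e => ?_
  have hp : MeasurePreserving (fun U : Clocks d => U e) (clockMeasure d) volume :=
    measurePreserving_eval_infinitePi _ e
  have hs : Set.Subsingleton {x : unitInterval | (x : ℝ) = t} :=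
    fun x hx y hy => Subtype.ext (hx.trans hy.symm)
  have : ∀ᵐ x : unitInterval, (x : ℝ) ≠ t := by
    rw [ae_iff]
    simpa using hs.measure_zero volume
  exact hp.quasiMeasurePreserving.ae this

theorem ae_injective : ∀ᵐ U ∂clockMeasure d, Function.Injective U := by
  have : ∀ᵐ U ∂clockMeasure d, ∀ e f, e ≠ f → U e ≠ U f := by
    refine ae_all_iff.2 fun e => ae_all_iff.2 fun f => ?_
    by_cases hef : e = f
    · simp [hef]
    have hm : MeasurableSet {P : Clocks d × Clocks d | P.2 e ≠ P.1 f} :=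
      (measurableSet_eq_fun ((measurable_pi_apply e).comp measurable_snd)
        ((measurable_pi_apply f).comp measurable_fst)).compl
    have hprod : ∀ᵐ P ∂(clockMeasure d).prod (clockMeasure d), P.2 e ≠ P.1 f := by
      rw [Measure.ae_prod_iff_ae_ae hm]
      refine .of_forall fun U => ?_
      filter_upwards [ae_ne_time (U f : ℝ)] with V hV h
      exact hV e (congrArg Subtype.val h)
    have hm' : MeasurableSet {U : Clocks d | e ≠ f → U e ≠ U f} := by
      simp only [ne_eq, hef, not_false_eq_true, forall_const]
      exact (measurableSet_eq_fun (measurable_pi_apply e) (measurable_pi_apply f)).compl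
    rw [← (measurePreserving_resample {e}).map_eq,
      ae_map_iff (measurable_resample {e}).aemeasurable hm']
    filter_upwards [hprod] with P hP _
    simpa [resample, Ne.symm hef] using hP
  filter_upwards [this] with U hU e f hef
  by_contra h
  exact hU e f h hef

/-- The last open edge at `v` to ring saw fewer than `k` others. Without ties, these are all the
others. -/
theorem encard_neighborSet_openGraph_le {U : Clocks d} (hU : Function.Injective U)
    (v : Fin d → ℤ) : ((openGraph k U t).neighborSet v).encard ≤ k := by
  rw [← encard_edges_at openGraph_le]
  simp only [mem_edgeSet_openGraph]
  set A : Set (Edge d) := {f | v ∈ f.1 ∧ IsOpen k U t f} with hA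
  have hfin : A.Finite := (finite_edges_at v).subset fun f hf => hf.1
  rcases A.eq_empty_or_nonempty with h0 | hne
  · simp [h0]
  obtain ⟨e, he, hmax⟩ := Set.exists_max_image A U hfin hne
  by_cases hwf : WellFounded (Earlier U)
  · have h1 := (succeeds_iff k U hwf e).1 he.2.2 v he.1
    have hsub : A ⊆ insert e {f : Edge d | v ∈ f.1 ∧ U f < U e ∧ Succeeds k U f} := by
      intro f hf
      by_cases hfe : f = e
      · exact .inl hfe
      · exact .inr ⟨hf.1, lt_of_le_of_ne (hmax f hf) fun h => hfe (hU h), hf.2.2⟩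
    refine (Set.encard_le_encard hsub).trans ((Set.encard_insert_le _ _).trans ?_)
    exact Order.add_one_le_of_lt h1
  · exact absurd he.2.2 (not_succeeds_of_not_wellFounded hwf e)

end Ties

end

section

/-! ### Invariance under graph isomorphisms and translations. -/

section Iso

variable {V W : Type*} {G : SimpleGraph V} {G' : SimpleGraph W}

theorem infAt_iff_of_iso (φ : G ≃g G') (x : V) : InfAt G x ↔ InfAt G' (φ x) := by
  unfold InfAt
  have : {y | G'.Reachable (φ x) y} = φ.toEquiv '' {y | G.Reachable x y} := by
    ext y
    rw [Equiv.image_eq_preimage_symm]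
    change _ ↔ G.Reachable x (φ.symm y)
    rw [← φ.reachable_iff, φ.apply_symm_apply]
    rfl
  rw [this, Set.infinite_image_iff φ.toEquiv.injective.injOn]

/-- An isomorphism restricts to the graphs with a vertex cleared. -/
def clearIso (φ : G ≃g G') (x : V) : clear G {x} ≃g clear G' {φ x} where
  toEquiv := φ.toEquiv
  map_rel_iff' := by
    intro a b
    have h : ∀ a, φ a ∈ ({φ x} : Set W) ↔ a ∈ ({x} : Set V) := fun a => φ.injective.eq_iff
    change G'.Adj (φ a) (φ b) ∧ φ a ∉ ({φ x} : Set W) ∧ φ b ∉ ({φ x} : Set W) ↔ _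
    rw [φ.map_adj_iff, h, h]
    rfl

theorem IsTrif.of_iso (φ : G ≃g G') {x : V} (h : IsTrif G x) : IsTrif G' (φ x) := by
  obtain ⟨a, hadj, hinf, hsep⟩ := h
  refine ⟨fun i => φ (a i), fun i => φ.map_adj_iff.2 (hadj i), fun i => ?_, fun i j hij hr => ?_⟩
  · exact (infAt_iff_of_iso (clearIso φ x) (a i)).1 (hinf i)
  · exact hsep i j hij ((clearIso φ x).reachable_iff.1 hr)

theorem isTrif_iff_of_iso (φ : G ≃g G') (x : V) : IsTrif G x ↔ IsTrif G' (φ x) :=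
  ⟨fun h => h.of_iso φ, fun h => by simpa using h.of_iso φ.symm⟩

theorem isTip_iff_of_iso (φ : G ≃g G') (x : V) : IsTip G x ↔ IsTip G' (φ x) := by
  unfold IsTip
  rw [infAt_iff_of_iso φ]
  refine and_congr_right fun _ => ?_
  rw [Set.encard_congr (φ.mapNeighborSet x)]

theorem InfMany.of_iso {ι : Type*} (φ : G ≃g G') (h : InfMany ι G) : InfMany ι G' := by
  obtain ⟨x, hinf, hsep⟩ := h
  exact ⟨fun i => φ (x i), fun i => (infAt_iff_of_iso φ _).1 (hinf i),
    fun i j hij hr => hsep i j hij (φ.reachable_iff.1 hr)⟩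

theorem infMany_iff_of_iso {ι : Type*} (φ : G ≃g G') : InfMany ι G ↔ InfMany ι G' :=
  ⟨fun h => h.of_iso φ, fun h => h.of_iso φ.symm⟩

end Iso

variable {d k : ℕ} {t : ℝ}

section Shift

/-- Translation by `z`, as an automorphism of the lattice. -/
def shiftIso (z : Fin d → ℤ) : lattice d ≃g lattice d where
  toEquiv := Equiv.addRight z
  map_rel_iff' := by intro a b; simp [lattice]

/-- Translation by `z`, acting on edges. -/
def shiftEdge (z : Fin d → ℤ) : Edge d ≃ Edge d := (shiftIso z).mapEdgeSet

theorem mem_shiftEdge (z v : Fin d → ℤ) (e : Edge d) : v + z ∈ (shiftEdge z e).1 ↔ v ∈ e.1 := by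
  obtain ⟨e, he⟩ := e
  induction e with
  | _ x y =>
    change v + z ∈ s(x + z, y + z) ↔ v ∈ s(x, y)
    simp

theorem mem_shiftEdge' (z v : Fin d → ℤ) (e : Edge d) :
    v ∈ (shiftEdge z e).1 ↔ v - z ∈ e.1 := by
  rw [← mem_shiftEdge z (v - z) e, sub_add_cancel]

/-- Translation by `z`, acting on collections of clocks. -/
def shift (z : Fin d → ℤ) (U : Clocks d) : Clocks d := fun e => U (shiftEdge z e)

theorem measurable_shift (z : Fin d → ℤ) : Measurable (shift z) :=
  measurable_pi_iff.2 fun e => measurable_pi_apply (shiftEdge z e)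

theorem measurePreserving_shift (z : Fin d → ℤ) :
    MeasurePreserving (shift z) (clockMeasure d) (clockMeasure d) := by
  refine ⟨measurable_shift z, Measure.eq_infinitePi _ fun s T hT => ?_⟩
  have hpre : shift z ⁻¹' (Set.pi s T) =
      Set.pi (s.map (shiftEdge z).toEmbedding) fun e => T ((shiftEdge z).symm e) := by
    ext U
    constructor
    · intro h e he
      obtain ⟨f, hf, rfl⟩ := Finset.mem_map.1 he
      simpa [shift] using h f hf
    · intro h f hf
      simpa [shift] using h (shiftEdge z f) (Finset.mem_map_of_mem _ hf)
  rw [Measure.map_apply (measurable_shift z) (.pi s.countable_toSet fun i _ => hT i), hpre,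
    clockMeasure, Measure.infinitePi_pi _ fun i _ => hT _, Finset.prod_map]
  simp

theorem earlier_shift (z : Fin d → ℤ) (U : Clocks d) (f e : Edge d) :
    Earlier (shift z U) f e ↔ Earlier U (shiftEdge z f) (shiftEdge z e) := by
  refine and_congr ⟨?_, ?_⟩ Iff.rfl
  · rintro ⟨v, h1, h2⟩
    exact ⟨v + z, (mem_shiftEdge z v f).2 h1, (mem_shiftEdge z v e).2 h2⟩
  · rintro ⟨v, h1, h2⟩
    exact ⟨v - z, (mem_shiftEdge' z v f).1 h1, (mem_shiftEdge' z v e).1 h2⟩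

theorem wellFounded_earlier_shift (z : Fin d → ℤ) (U : Clocks d) :
    WellFounded (Earlier (shift z U)) ↔ WellFounded (Earlier U) := by
  let r : Earlier (shift z U) ≃r Earlier U :=
    ⟨shiftEdge z, fun {f e} => (earlier_shift z U f e).symm⟩
  exact ⟨fun h => r.symm.toRelEmbedding.wellFounded h, fun h => r.toRelEmbedding.wellFounded h⟩

theorem succeeds_shift (z : Fin d → ℤ) (U : Clocks d) (e : Edge d) :
    Succeeds k (shift z U) e ↔ Succeeds k U (shiftEdge z e) := by
  by_cases h : WellFounded (Earlier (shift z U))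
  · have h' := (wellFounded_earlier_shift z U).1 h
    induction e using h.induction with
    | _ e ih =>
      rw [succeeds_iff k _ h, succeeds_iff k _ h']
      have key : ∀ v ∈ e.1,
          {f : Edge d | v + z ∈ f.1 ∧ U f < U (shiftEdge z e) ∧ Succeeds k U f} =
          shiftEdge z '' {f : Edge d | v ∈ f.1 ∧ shift z U f < shift z U e ∧
            Succeeds k (shift z U) f} := by
        intro v hv
        ext f
        obtain ⟨g, rfl⟩ := (shiftEdge z).surjective f
        rw [(shiftEdge z).injective.mem_set_image]
        change (v + z ∈ (shiftEdge z g).1 ∧ _) ↔ _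
        rw [mem_shiftEdge]
        exact and_congr_right fun hvg => and_congr_right fun hlt =>
          (ih g ⟨⟨v, hvg, hv⟩, hlt⟩).symm
      have hcard : ∀ v ∈ e.1,
          {f : Edge d | v + z ∈ f.1 ∧ U f < U (shiftEdge z e) ∧ Succeeds k U f}.encard =
          {f : Edge d | v ∈ f.1 ∧ shift z U f < shift z U e ∧
            Succeeds k (shift z U) f}.encard := fun v hv => by
        rw [key v hv, (shiftEdge z).injective.encard_image]
      constructor
      · intro hs v hv
        have hv' := (mem_shiftEdge' z v e).1 hv
        have := hcard _ hv'
        rw [sub_add_cancel] at this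
        exact this ▸ hs _ hv'
      · intro hs v hv
        exact hcard v hv ▸ hs _ ((mem_shiftEdge z v e).2 hv)
  · exact iff_of_false (not_succeeds_of_not_wellFounded h e)
      (not_succeeds_of_not_wellFounded (fun h' => h ((wellFounded_earlier_shift z U).2 h')) _)

/-- Translating the clocks translates the open graph. -/
def openGraphShiftIso (k : ℕ) (t : ℝ) (z : Fin d → ℤ) (U : Clocks d) :
    openGraph k (shift z U) t ≃g openGraph k U t where
  toEquiv := Equiv.addRight z
  map_rel_iff' := by
    intro a b
    constructor
    · rintro ⟨h, h1, h2⟩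
      have h' : (lattice d).Adj a b := (shiftIso z).map_adj_iff.1 h
      exact ⟨h', h1, (succeeds_shift z U ⟨s(a, b), h'⟩).2 h2⟩
    · rintro ⟨h, h1, h2⟩
      exact ⟨(shiftIso z).map_adj_iff.2 h, h1, (succeeds_shift z U ⟨s(a, b), h⟩).1 h2⟩

end Shift

/-! ### Ergodicity under translations. -/

section Ergodic

/-- The event `B` is determined by the clocks on `F`. -/
def DeterminedBy (F : Finset (Edge d)) (B : Set (Clocks d)) : Prop :=
  ∀ U U' : Clocks d, (∀ e ∈ F, U e = U' e) → (U ∈ B ↔ U' ∈ B)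

/-- After resampling `F'`, the event `B` depends only on the first copy of the clocks and `B'` only
on the second. -/
theorem DeterminedBy.measure_inter {F F' : Finset (Edge d)} {B B' : Set (Clocks d)}
    (hB : DeterminedBy F B) (hB' : DeterminedBy F' B') (hmB : MeasurableSet B)
    (hmB' : MeasurableSet B') (hdisj : Disjoint F F') :
    clockMeasure d (B ∩ B') = clockMeasure d B * clockMeasure d B' := by
  rw [← (measurePreserving_resample F').measure_preimage (hmB.inter hmB').nullMeasurableSet,
    ← Measure.prod_prod]
  congr 1
  ext ⟨U, V⟩
  refine and_congr ?_ ?_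
  · refine hB _ _ fun e he => ?_
    simp [resample, Finset.disjoint_left.1 hdisj he]
  · refine hB' _ _ fun e he => ?_
    simp [resample, he]

theorem DeterminedBy.preimage_shift {F : Finset (Edge d)} {B : Set (Clocks d)}
    (hB : DeterminedBy F B) (z : Fin d → ℤ) :
    DeterminedBy (F.map (shiftEdge z).toEmbedding) (shift z ⁻¹' B) :=
  fun _ _ h => hB _ _ fun _ he => h _ (Finset.mem_map_of_mem _ he)

theorem exists_disjoint_map_shiftEdge (hd : 1 ≤ d) (F : Finset (Edge d)) :
    ∃ z : Fin d → ℤ, Disjoint F (F.map (shiftEdge z).toEmbedding) := by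
  classical
  set W : Set (Fin d → ℤ) := ⋃ e ∈ F, {v | v ∈ e.1} with hW
  have hWfin : W.Finite := F.finite_toSet.biUnion fun e _ =>
    (e.1.toFinset.finite_toSet).subset fun v hv => by simpa using hv
  have hsub : (Set.image2 (fun v w => v - w) W W).Finite := hWfin.image2 _ hWfin
  have : Infinite (Fin d → ℤ) := by
    have : Nonempty (Fin d) := ⟨⟨0, hd⟩⟩
    infer_instance
  obtain ⟨z, hz⟩ := hsub.exists_notMem
  refine ⟨z, Finset.disjoint_left.2 fun e he he' => ?_⟩
  obtain ⟨f, hf, rfl⟩ := Finset.mem_map.1 he'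
  obtain ⟨v, hv⟩ : ∃ v, v ∈ f.1 := ⟨_, Sym2.out_fst_mem f.1⟩
  exact hz ⟨v + z, Set.mem_biUnion he ((mem_shiftEdge z v f).2 hv), v, Set.mem_biUnion hf hv,
    by simp⟩

/-- The law of the clocks is ergodic under translations. -/
theorem measure_eq_zero_or_one_of_shift_invariant (hd : 1 ≤ d) {A : Set (Clocks d)}
    (hA : MeasurableSet A) (hinv : ∀ z, shift z ⁻¹' A = A) :
    clockMeasure d A = 0 ∨ clockMeasure d A = 1 := by
  set μ := clockMeasure d with hμ
  -- Approximate `A` within `ε` by a cylinder `B`. A far translate of `B` is independent of it and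
  -- approximates `A` equally well, so `μ(B)²` is within `2ε` of both `μ(A)` and `μ(A)²`.
  have key : ∀ ε : ℝ, 0 < ε → |μ.real A - μ.real A ^ 2| ≤ 4 * ε := by
    intro ε hε
    obtain ⟨B, hBC, hB⟩ := exists_measure_symmDiff_lt_of_generateFrom_isSetRing (μ := μ)
      (isSetRing_measurableCylinders (α := fun _ : Edge d => unitInterval))
      ⟨{Set.univ}, Set.countable_singleton _,
        Set.singleton_subset_iff.2 (univ_mem_measurableCylinders _), by simp⟩
      (generateFrom_measurableCylinders).symm hA (ENNReal.ofReal_pos.2 hε)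
    obtain ⟨F, S, hS, rfl⟩ := (mem_measurableCylinders _).1 hBC
    set B := cylinder (α := fun _ : Edge d => unitInterval) F S with hBdef
    have hmB : MeasurableSet B := hS.cylinder _
    have hdet : DeterminedBy F B := by
      intro U U' h
      have : F.restrict U = F.restrict U' := funext fun e => h e e.2
      simp only [hBdef, mem_cylinder, this]
    obtain ⟨z, hz⟩ := exists_disjoint_map_shiftEdge hd F
    have hmB' : MeasurableSet (shift z ⁻¹' B) := measurable_shift z hmB
    have h1 : μ.real (B ∩ shift z ⁻¹' B) = μ.real B ^ 2 := by
      rw [measureReal_def, hdet.measure_inter (hdet.preimage_shift z) hmB hmB' hz,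
        (measurePreserving_shift z).measure_preimage hmB.nullMeasurableSet, ENNReal.toReal_mul, sq]
      rfl
    have h2 : μ.real (symmDiff B A) ≤ ε := by
      refine ENNReal.toReal_le_of_le_ofReal hε.le hB.le
    have h3 : μ.real (symmDiff (shift z ⁻¹' B) A) ≤ ε := by
      have : symmDiff (shift z ⁻¹' B) A = shift z ⁻¹' (symmDiff B A) := by
        rw [Set.preimage_symmDiff, hinv z]
      rw [this, measureReal_def,
        (measurePreserving_shift z).measure_preimage (hmB.symmDiff hA).nullMeasurableSet]
      exact h2
    have h4 : μ.real (symmDiff (B ∩ shift z ⁻¹' B) A) ≤ 2 * ε := by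
      have hsub : symmDiff (B ∩ shift z ⁻¹' B) A ⊆ symmDiff B A ∪ symmDiff (shift z ⁻¹' B) A := by
        intro U
        simp only [Set.mem_symmDiff, Set.mem_inter_iff, Set.mem_union]
        tauto
      have := (measureReal_mono hsub).trans (measureReal_union_le (μ := μ) _ _)
      linarith
    have h5 := (abs_measureReal_sub_le_measureReal_symmDiff (μ := μ) hmB.nullMeasurableSet
      hA.nullMeasurableSet).trans h2
    have h6 := (abs_measureReal_sub_le_measureReal_symmDiff (μ := μ)
      (hmB.inter hmB').nullMeasurableSet hA.nullMeasurableSet).trans h4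
    rw [h1] at h6
    have hb0 : 0 ≤ μ.real B := measureReal_nonneg
    have hb1 : μ.real B ≤ 1 := measureReal_le_one
    have ha0 : 0 ≤ μ.real A := measureReal_nonneg
    have ha1 : μ.real A ≤ 1 := measureReal_le_one
    have h7 : |μ.real B ^ 2 - μ.real A ^ 2| ≤ 2 * ε := by
      have : μ.real B ^ 2 - μ.real A ^ 2 = (μ.real B - μ.real A) * (μ.real B + μ.real A) := by ring
      rw [this, abs_mul, abs_of_nonneg (add_nonneg hb0 ha0)]
      nlinarith [abs_nonneg (μ.real B - μ.real A)]
    rw [abs_le] at *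
    constructor <;> linarith [h6.1, h6.2, h7.1, h7.2]
  have h0 : |μ.real A - μ.real A ^ 2| ≤ 0 := by
    refine le_of_forall_pos_le_add fun ε hε => ?_
    have := key (ε / 4) (by linarith)
    linarith
  have h1 : μ.real A * (1 - μ.real A) = 0 := by
    have := abs_eq_zero.1 (le_antisymm h0 (abs_nonneg _))
    linarith
  rcases mul_eq_zero.1 h1 with h | h
  · left
    exact (measureReal_eq_zero_iff (measure_ne_top _ _)).1 h
  · right
    have h' : (μ A).toReal = 1 := by rw [← measureReal_def]; linarith
    rw [← ENNReal.ofReal_toReal (measure_ne_top μ A), h', ENNReal.ofReal_one]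

/-- A property of graphs that is invariant under isomorphisms holds almost surely for the open
graph as soon as it holds with positive probability. -/
theorem ae_of_not_ae_not (hd : 1 ≤ d) {Q : SimpleGraph (Fin d → ℤ) → Prop}
    (hm : Measurable fun U : Clocks d => Q (openGraph k U t))
    (hiso : ∀ G G' : SimpleGraph (Fin d → ℤ), Nonempty (G ≃g G') → (Q G ↔ Q G'))
    (h : ¬ ∀ᵐ U ∂clockMeasure d, ¬ Q (openGraph k U t)) :
    ∀ᵐ U ∂clockMeasure d, Q (openGraph k U t) := by
  have hmeas : MeasurableSet {U : Clocks d | Q (openGraph k U t)} := measurableSet_setOfPred.2 hm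
  rcases measure_eq_zero_or_one_of_shift_invariant hd hmeas fun z => by
    ext U
    exact hiso _ _ ⟨openGraphShiftIso k t z U⟩ with h0 | h1
  · exact absurd (by simpa [ae_iff] using h0) h
  · exact (prob_compl_eq_zero_iff hmeas).2 h1

end Ergodic

end

variable {d k : ℕ} {t : ℝ}

/-! ### Amenability: boxes have negligible boundary. -/

section Amenable

/-- The box `[-n, n]^d`. -/
def box (d n : ℕ) : Finset (Fin d → ℤ) := Finset.Icc (fun _ => -(n : ℤ)) (fun _ => (n : ℤ))

theorem card_box (d n : ℕ) : (box d n).card = (2 * n + 1) ^ d := by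
  rw [box, Pi.card_Icc]
  have : ((n : ℤ) + 1 + (n : ℤ)).toNat = 2 * n + 1 := by omega
  simp [this]

theorem box_subset (d n : ℕ) : box d n ⊆ box d (n + 1) :=
  Finset.Icc_subset_Icc (fun _ => by push_cast; omega) (fun _ => by push_cast; omega)

theorem adj_mem_box {n : ℕ} {x y : Fin d → ℤ} (hx : x ∈ box d n) (h : (lattice d).Adj x y) :
    y ∈ box d n ∨ y ∈ box d (n + 1) \ box d n := by
  suffices y ∈ box d (n + 1) by
    by_cases hy : y ∈ box d n
    · exact .inl hy
    · exact .inr (Finset.mem_sdiff.2 ⟨this, hy⟩)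
  have hw : ∑ i, |x i - y i| = 1 := h
  have h1 : ∀ i, |x i - y i| ≤ 1 := fun i =>
    hw ▸ Finset.single_le_sum (f := fun i => |x i - y i|) (fun i _ => abs_nonneg _)
      (Finset.mem_univ i)
  obtain ⟨hx1, hx2⟩ := Finset.mem_Icc.1 hx
  refine Finset.mem_Icc.2 ⟨fun i => ?_, fun i => ?_⟩
  · have := abs_le.1 (h1 i)
    have := hx1 i
    push_cast
    simp only at this
    omega
  · have := abs_le.1 (h1 i)
    have := hx2 i
    push_cast
    simp only at this
    omega

/-- A translation invariant random set of vertices that has at most as many points in any box as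
the box has boundary points is almost surely empty. -/
theorem ae_forall_not_of_card_le {Q : SimpleGraph (Fin d → ℤ) → (Fin d → ℤ) → Prop}
    (hm : ∀ x, Measurable fun U : Clocks d => Q (openGraph k U t) x)
    (hiso : ∀ (G G' : SimpleGraph (Fin d → ℤ)) (φ : G ≃g G') (x), Q G x ↔ Q G' (φ x))
    (hcard : ∀ᵐ U ∂clockMeasure d, ∀ n, ∀ T ⊆ box d n, (∀ x ∈ T, Q (openGraph k U t) x) →
      T.card ≤ (box d (n + 1) \ box d n).card) :
    ∀ᵐ U ∂clockMeasure d, ∀ x, ¬ Q (openGraph k U t) x := by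
  classical
  set μ := clockMeasure d with hμ
  set E : (Fin d → ℤ) → Set (Clocks d) := fun x => {U | Q (openGraph k U t) x} with hE
  have hmE : ∀ x, MeasurableSet (E x) := fun x => measurableSet_setOfPred.2 (hm x)
  have hinv : ∀ x, μ (E x) = μ (E 0) := by
    intro x
    rw [← (measurePreserving_shift x).measure_preimage (hmE 0).nullMeasurableSet]
    congr 1
    ext U
    have := hiso _ _ (openGraphShiftIso k t x U) 0
    rw [show openGraphShiftIso k t x U 0 = x from zero_add x] at this
    exact this.symm
  -- By invariance the left side is the expected number of points of the random set in the box.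
  have hbound : ∀ n : ℕ, (box d n).card * μ (E 0) ≤ (box d (n + 1) \ box d n).card := by
    intro n
    have h1 : ∑ x ∈ box d n, μ (E x) = (box d n).card * μ (E 0) := by
      simp [hinv]
    rw [← h1]
    have h2 : ∑ x ∈ box d n, μ (E x) = ∫⁻ U, ∑ x ∈ box d n, (E x).indicator 1 U ∂μ := by
      rw [lintegral_finsetSum _ fun x _ => measurable_one.indicator (hmE x)]
      exact Finset.sum_congr rfl fun x _ => (lintegral_indicator_one (hmE x)).symm
    rw [h2]
    refine (lintegral_mono_ae (g := fun _ => ((box d (n + 1) \ box d n).card : ENNReal)) ?_).trans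
      (by simp)
    filter_upwards [hcard] with U hU
    have h3 : ∑ x ∈ box d n, (E x).indicator (1 : Clocks d → ENNReal) U =
        ((box d n).filter fun x => U ∈ E x).card := by
      simp [Set.indicator_apply]
    rw [h3]
    exact_mod_cast hU n _ (Finset.filter_subset _ _) fun x hx => (Finset.mem_filter.1 hx).2
  -- The right side is the ratio of boundary to volume, `((2n+3)/(2n+1))^d - 1`.
  have hreal : ∀ n : ℕ, μ.real (E 0) ≤ (1 + 2 / (2 * (n : ℝ) + 1)) ^ d - 1 := by
    intro n
    have h1 := ENNReal.toReal_mono (by simp) (hbound n)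
    rw [ENNReal.toReal_mul, ENNReal.toReal_natCast, ENNReal.toReal_natCast,
      Finset.cast_card_sdiff (box_subset d n), card_box, card_box] at h1
    push_cast at h1
    have hpos : (0 : ℝ) < 2 * n + 1 := by positivity
    have h2 : 1 + 2 / (2 * (n : ℝ) + 1) = (2 * (n + 1) + 1) / (2 * n + 1) := by
      field_simp; ring
    rw [h2, div_pow, le_sub_iff_add_le, le_div_iff₀ (by positivity)]
    have h3 : μ.real (E 0) = (μ (E 0)).toReal := rfl
    rw [h3]
    linarith
  have hlim : Filter.Tendsto (fun n : ℕ => (1 + 2 / (2 * (n : ℝ) + 1)) ^ d - 1) Filter.atTop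
      (nhds 0) := by
    have h1 : Filter.Tendsto (fun n : ℕ => 2 / (2 * (n : ℝ) + 1)) Filter.atTop (nhds 0) := by
      refine Filter.Tendsto.const_div_atTop ?_ 2
      exact Filter.tendsto_atTop_add_const_right _ _
        (tendsto_natCast_atTop_atTop.const_mul_atTop (by norm_num))
    simpa using ((h1.const_add 1).pow d).sub_const 1
  have h0 : μ.real (E 0) = 0 :=
    le_antisymm (ge_of_tendsto' hlim hreal) measureReal_nonneg
  have h0' : μ (E 0) = 0 := (measureReal_eq_zero_iff (measure_ne_top _ _)).1 h0
  refine ae_all_iff.2 fun x => ?_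
  have := (hinv x).trans h0'
  simpa [ae_iff, hE] using this

theorem ae_not_isTrif (k : ℕ) (t : ℝ) :
    ∀ᵐ U ∂clockMeasure d, ∀ x, ¬ IsTrif (openGraph k U t) x := by
  classical
  refine ae_forall_not_of_card_le (fun x => measurable_isTrif measurable_openGraph x)
    (fun _ _ φ x => isTrif_iff_of_iso φ x) (.of_forall fun U n T hT h => ?_)
  exact card_trif_le (fun x hx y hxy => adj_mem_box hx (openGraph_le hxy)) hT h

theorem ae_not_isTip (hk : k ≤ 2) (t : ℝ) :
    ∀ᵐ U ∂clockMeasure d, ∀ x, ¬ IsTip (openGraph k U t) x := by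
  classical
  refine ae_forall_not_of_card_le (fun x => measurable_isTip measurable_openGraph x)
    (fun _ _ φ x => isTip_iff_of_iso φ x) ?_
  filter_upwards [ae_injective] with U hU n T hT h
  exact card_tip_le (fun v => (encard_neighborSet_openGraph_le hU v).trans (by exact_mod_cast hk))
    (fun x hx y hxy => adj_mem_box hx (openGraph_le hxy)) hT h

end Amenable

/-! ### Uniqueness of the infinite cluster. -/

section Uniqueness

theorem InfMany.infAt {V ι : Type*} [Nonempty ι] {G : SimpleGraph V} (h : InfMany ι G) :
    ∃ x, InfAt G x := by
  obtain ⟨x, hx, -⟩ := h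
  exact ⟨_, hx (Classical.arbitrary ι)⟩

/-- With constraint at most two there is no infinite cluster at times `t < 1`. -/
theorem ae_not_infAt_of_le_two (hk : k ≤ 2) (ht0 : 0 < t) (ht1 : t < 1) :
    ∀ᵐ U ∂clockMeasure d, ∀ x, ¬ InfAt (openGraph k U t) x := by
  have h := ae_forall_isEdit_not (k := k) (Q := fun G => ∃ x, IsTip G x) ht0 ht1 (by
    filter_upwards [ae_not_isTip (d := d) hk t] with U hU ⟨x, hx⟩
    exact hU x hx)
  filter_upwards [h, ae_injective] with U hU hinj x hx
  obtain ⟨G', hG', htip⟩ := exists_isEdit_isTip openGraph_le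
    (encard_neighborSet_openGraph_le hinj) hx
  exact hU (wellFounded_of_infAt hx) G' hG' ⟨x, htip⟩

/-- Uniqueness: at times `t < 1` there is almost surely at most one infinite cluster. -/
theorem ae_not_infMany_two (hd : 1 ≤ d) (ht0 : 0 < t) (ht1 : t < 1) :
    ∀ᵐ U ∂clockMeasure d, ¬ InfMany (Fin 2) (openGraph k U t) := by
  rcases Nat.lt_or_ge 2 k with hk | hk
  · have h3 : ∀ᵐ U ∂clockMeasure d, ¬ InfMany (Fin 3) (openGraph k U t) := by
      have h := ae_forall_isEdit_not (k := k) (Q := fun G => ∃ x, IsTrif G x) ht0 ht1 (by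
        filter_upwards [ae_not_isTrif (d := d) k t] with U hU ⟨x, hx⟩
        exact hU x hx)
      filter_upwards [h, ae_injective] with U hU hinj hinf
      obtain ⟨x, hx⟩ := hinf.infAt
      obtain ⟨G', hG', htrif⟩ := exists_isEdit_isTrif (lattice_preconnected d) openGraph_le
        (encard_neighborSet_openGraph_le hinj) hk hinf
      exact hU (wellFounded_of_infAt hx) G' hG' htrif
    -- By ergodicity there would almost surely be two infinite clusters but not three. Finite energy
    -- then forbids every edit with at least three or at most one, and such an edit exists.
    by_contra hnot
    have h2 := ae_of_not_ae_not hd (measurable_infMany measurable_openGraph)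
      (fun G G' ⟨φ⟩ => infMany_iff_of_iso φ) hnot
    have h := ae_forall_isEdit_not (k := k)
      (Q := fun G => InfMany (Fin 3) G ∨ ¬ InfMany (Fin 2) G) ht0 ht1 (by
        filter_upwards [h2, h3] with U hU2 hU3
        rintro (h | h)
        · exact hU3 h
        · exact h hU2)
    have hfalse : ∀ᵐ U ∂clockMeasure d, False := by
      filter_upwards [h, h2, ae_injective] with U hU hinf hinj
      obtain ⟨x, hx⟩ := hinf.infAt
      obtain ⟨G', hG', hQ⟩ := exists_isEdit_infMany_three_or (lattice_preconnected d) openGraph_le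
        (encard_neighborSet_openGraph_le hinj) (by omega) hinf
      exact hU (wellFounded_of_infAt hx) G' hG' hQ
    obtain ⟨_, h⟩ := hfalse.exists
    exact h
  · filter_upwards [ae_not_infAt_of_le_two (d := d) hk ht0 ht1] with U hU hinf
    obtain ⟨x, hx⟩ := hinf.infAt
    exact hU x hx

end Uniqueness

/-! ### One-sided limits of the percolation function. -/

section Continuity

/-- The event that the cluster of the origin is infinite at time `t`. -/
def percolates (d k : ℕ) (t : ℝ) : Set (Clocks d) := {U | InfAt (openGraph k U t) 0}

theorem theta_eq (t : ℝ) : theta d k t = (clockMeasure d).real (percolates d k t) := rfl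

theorem measurableSet_percolates (t : ℝ) : MeasurableSet (percolates d k t) :=
  measurableSet_setOfPred.2 (measurable_infAt measurable_openGraph 0)

theorem openGraph_mono {s : ℝ} (hst : s ≤ t) (U : Clocks d) :
    openGraph k U s ≤ openGraph k U t :=
  fun _ _ ⟨h, h1, h2⟩ => ⟨h, h1.trans hst, h2⟩

theorem percolates_mono : Monotone (percolates d k) :=
  fun _ _ hst U h => InfAt.mono (openGraph_mono hst U) h

theorem theta_mono : Monotone (theta d k) :=
  fun _ _ hst => measureReal_mono (percolates_mono hst)

/-- An infinite cluster at all times after `t` is infinite at time `t`. -/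
theorem iInter_percolates (t : ℝ) :
    ⋂ n : ℕ, percolates d k (t + 1 / ((n : ℝ) + 1)) = percolates d k t := by
  refine Set.Subset.antisymm (fun U hU => ?_) (Set.subset_iInter fun n =>
    percolates_mono (le_add_of_nonneg_right (by positivity)))
  intro hfin
  set C : Set (Fin d → ℤ) := {y | (openGraph k U t).Reachable 0 y} with hC
  have hfinE := (finite_edges_meeting (d := d) hfin)
  -- Finitely many edges touch the finite cluster `C`, so one `n` serves for all, and `C` is still
  -- closed under open edges at time `t + 1/(n+1)`.
  obtain ⟨n, hn⟩ : ∃ n : ℕ, ∀ e : Edge d, (∃ v ∈ C, v ∈ e.1) → t < U e →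
      t + 1 / ((n : ℝ) + 1) < U e := by
    have h1 : ∀ e : Edge d, ∀ᶠ n : ℕ in Filter.atTop, t < U e → t + 1 / ((n : ℝ) + 1) < U e := by
      intro e
      by_cases he : t < U e
      · have := (tendsto_one_div_add_atTop_nhds_zero_nat (𝕜 := ℝ)).const_add t
        rw [add_zero] at this
        exact (this.eventually_lt_const he).mono fun n hn _ => hn
      · exact .of_forall fun n h => absurd h he
    obtain ⟨n, hn⟩ := ((Filter.eventually_all_finite hfinE).2 fun e _ => h1 e).exists
    exact ⟨n, hn⟩
  refine Set.mem_iInter.1 hU n (hfin.subset fun y hy => ?_)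
  refine reachable_induction (P := fun y => y ∈ C) hy .rfl ?_
  rintro u w - hu ⟨hadj, h1, h2⟩
  refine SimpleGraph.Reachable.trans hu (SimpleGraph.Adj.reachable ⟨hadj, ?_, h2⟩)
  by_contra! hlt
  exact absurd h1 (not_le.2 (hn _ ⟨u, hu, Sym2.mem_mk_left u w⟩ hlt))

/-- If no clock equals `t`, then vertices connected at time `t` are connected shortly before. -/
theorem eventually_reachable {U : Clocks d} (hU : ∀ e, (U e : ℝ) ≠ t) {x y : Fin d → ℤ}
    (h : (openGraph k U t).Reachable x y) :
    ∀ᶠ n : ℕ in Filter.atTop, (openGraph k U (t - 1 / ((n : ℝ) + 1))).Reachable x y := by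
  refine reachable_induction (P := fun y => ∀ᶠ n : ℕ in Filter.atTop,
    (openGraph k U (t - 1 / ((n : ℝ) + 1))).Reachable x y) h (.of_forall fun n => .rfl) ?_
  rintro u w - hu ⟨hadj, h1, h2⟩
  have hlim := (tendsto_one_div_add_atTop_nhds_zero_nat (𝕜 := ℝ)).const_sub t
  rw [sub_zero] at hlim
  filter_upwards [hu, hlim.eventually_const_lt (lt_of_le_of_ne h1 (hU _))] with n hn hlt
  exact hn.trans (SimpleGraph.Adj.reachable ⟨hadj, hlt.le, h2⟩)

/-- Above an earlier supercritical time, an infinite cluster at time `t` is almost surely infinite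
shortly before. -/
theorem ae_percolates_le_iUnion {s : ℝ} (hd : 1 ≤ d) (ht0 : 0 < t) (ht1 : t < 1) (hst : s < t)
    (hs : 0 < theta d k s) :
    percolates d k t ≤ᵐ[clockMeasure d] ⋃ n : ℕ, percolates d k (t - 1 / ((n : ℝ) + 1)) := by
  have hex : ∀ᵐ U ∂clockMeasure d, ∃ x, InfAt (openGraph k U s) x := by
    refine ae_of_not_ae_not (Q := fun G => ∃ x, InfAt G x) hd
      (Measurable.exists fun x => measurable_infAt measurable_openGraph x) ?_ fun h => ?_
    · rintro G G' ⟨φ⟩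
      exact ⟨fun ⟨x, hx⟩ => ⟨φ x, (infAt_iff_of_iso φ x).1 hx⟩,
        fun ⟨x, hx⟩ => ⟨φ.symm x, (infAt_iff_of_iso φ.symm x).1 hx⟩⟩
    · have h0 : clockMeasure d (percolates d k s) = 0 := by
        refine measure_mono_null (fun U hU => ?_) h
        exact not_not.2 ⟨0, hU⟩
      rw [theta_eq, measureReal_def, h0] at hs
      simp at hs
  filter_upwards [hex, ae_not_infMany_two (k := k) hd ht0 ht1, ae_ne_time t] with
    U ⟨x, hx⟩ huniq hne hU
  have hreach : (openGraph k U t).Reachable 0 x := by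
    by_contra hnot
    refine huniq ⟨![0, x], fun i => ?_, fun i j hij h => ?_⟩
    · fin_cases i
      · exact hU
      · exact hx.mono (openGraph_mono hst.le U)
    · fin_cases i <;> fin_cases j
      · exact hij rfl
      · exact hnot h
      · exact hnot h.symm
      · exact hij rfl
  have hlim := (tendsto_one_div_add_atTop_nhds_zero_nat (𝕜 := ℝ)).const_sub t
  rw [sub_zero] at hlim
  -- A time after `s` at which the origin is already connected to `x`, whose cluster has been
  -- infinite since time `s`.
  obtain ⟨n, hn, hsn⟩ :=
    ((eventually_reachable hne hreach).and (hlim.eventually_const_lt hst)).exists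
  exact Set.mem_iUnion.2 ⟨n, (hx.mono (openGraph_mono hsn.le U)).of_reachable hn.symm⟩

theorem continuousAt_theta {s : ℝ} (hd : 1 ≤ d) (ht0 : 0 < t) (ht1 : t < 1) (hst : s < t)
    (hs : 0 < theta d k s) : ContinuousAt (theta d k) t := by
  have hright : Filter.Tendsto (fun n : ℕ => theta d k (t + 1 / ((n : ℝ) + 1))) Filter.atTop
      (nhds (theta d k t)) := by
    have h := tendsto_measure_iInter_atTop (μ := clockMeasure d)
      (s := fun n : ℕ => percolates d k (t + 1 / ((n : ℝ) + 1)))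
      (fun n => (measurableSet_percolates _).nullMeasurableSet)
      (fun m n hmn => percolates_mono (by gcongr)) ⟨0, measure_ne_top _ _⟩
    rw [iInter_percolates] at h
    exact (ENNReal.tendsto_toReal (measure_ne_top _ _)).comp h
  have hleft : Filter.Tendsto (fun n : ℕ => theta d k (t - 1 / ((n : ℝ) + 1))) Filter.atTop
      (nhds (theta d k t)) := by
    have h := tendsto_measure_iUnion_atTop (μ := clockMeasure d)
      (s := fun n : ℕ => percolates d k (t - 1 / ((n : ℝ) + 1)))
      (fun m n hmn => percolates_mono (by gcongr))
    have heq : clockMeasure d (⋃ n : ℕ, percolates d k (t - 1 / ((n : ℝ) + 1))) =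
        clockMeasure d (percolates d k t) :=
      le_antisymm (measure_mono (Set.iUnion_subset fun n =>
        percolates_mono (sub_le_self _ (by positivity))))
        (measure_mono_ae (ae_percolates_le_iUnion hd ht0 ht1 hst hs))
    rw [heq] at h
    exact (ENNReal.tendsto_toReal (measure_ne_top _ _)).comp h
  have hpos : ∀ n : ℕ, (0 : ℝ) < 1 / ((n : ℝ) + 1) := fun n => by positivity
  -- By monotonicity the limits along the two sequences control a whole neighbourhood of `t`.
  refine tendsto_order.2 ⟨fun a ha => ?_, fun a ha => ?_⟩
  · obtain ⟨n, hn⟩ := (hleft.eventually_const_lt ha).exists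
    filter_upwards [lt_mem_nhds (sub_lt_self t (hpos n))] with u hu
    exact hn.trans_le (theta_mono hu.le)
  · obtain ⟨n, hn⟩ := (hright.eventually_lt_const ha).exists
    filter_upwards [gt_mem_nhds (lt_add_of_pos_right t (hpos n))] with u hu
    exact (theta_mono hu.le).trans_lt hn

end Continuity

end CDP

end

theorem theorem3 (d k : ℕ) (hk : 1 ≤ k) (hkd : k ≤ 2 * d) :
    ContinuousOn (CDP.theta d k) (Set.Ioo (CDP.criticalTime d k : ℝ) 1) := by
  rintro t ⟨htc, ht1⟩
  have ht0 : 0 < t := (CDP.criticalTime d k).2.1.trans_lt htc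
  have hlt : CDP.criticalTime d k < (⟨t, ht0.le, ht1.le⟩ : unitInterval) := htc
  obtain ⟨s, hs, hst⟩ := sInf_lt_iff.1 hlt
  exact (CDP.continuousAt_theta (by omega) ht0 ht1 hst hs).continuousWithinAt
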